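/- Conventions. An operator space is a complex normed space $E$ together with norms on all matrix spaces $M_n(E)$, extending the norm of $E=M_1(E)$, that satisfy Ruan's axioms $\|\alpha x\beta\|\le\|\alpha\|\|x\|\|\beta\|$ (for scalar matrices $\alpha,\beta$) and $\|x\oplus y\|=\max(\|x\|,\|y\|)$. For a linear map $T:E\to F$ put $\|T\|_{cb}=\sup_n\|\mathrm{id}\otimes T:M_n(E)\to M_n(F)\|$, and let $CB(E,F)$ be the space of all $T$ with $\|T\|_{cb}<\infty$, $CB(E)=CB(E,E)$. The dual $E^*$ carries the matrix norms $M_n(E^*)=CB(E,M_n(\mathbb C))$, and $E^{**}=(E^*)^*$. If $\mathcal U$ is an ultrafilter on a set $I$ and $(E_i)_{i\in I}$ is a family of operator spaces, the ultraproduct $\prod_{i\in I}E_i/\mathcal U$ is the quotient of the space of bounded families $(x_i)_{i\in I}$ with $x_i\in E_i$ by the subspace of those with $\lim_{\mathcal U}\|x_i\|=0$; its matrix norms are $\|(x_i)_{\mathcal U}\|_{M_n}=\lim_{\mathcal U}\|x_i\|_{M_n(E_i)}$. Let $K\ge 1$ be a constant and $k:\mathbb N\to\mathbb R$ a function. An operator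 space $E$ has the $(K,k(n))$-OUAP (uniform approximation property in the operator space sense) if for every $n$ and every $n$-dimensional subspace $M$ of $E$ there is a finite rank operator $T\in CB(E)$ with $$\|T\|_{cb}\le K,\qquad \operatorname{rank}T\le k(n),\qquad T|_M=\mathrm{id}_M .$$ Proposition. (1) The class of operator spaces having the $(K,k(n))$-OUAP is stable under ultraproducts: if $(E_i)_{i\in I}$ is a family of operator spaces each of which has the $(K,k(n))$-OUAP and $\mathcal U$ is an ultrafilter on $I$, then $\prod_{i\in I}E_i/\mathcal U$ has the $(K,k(n))$-OUAP. (2) If an operator space $E$ has the $(K,k(n))$-OUAP, then so does its bidual $E^{**}$. -/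

import Mathlib

noncomputable section

section OperatorSpaces

open scoped ENNReal Topology Matrix.Norms.L2Operator
open Filter

universe u v

/-- The product `α x β` of a matrix `x` over a complex vector space with scalar matrices. -/
def matBimul {E : Type*} [AddCommGroup E] [Module ℂ E] {m n : ℕ}
    (α : Matrix (Fin m) (Fin n) ℂ) (x : Matrix (Fin n) (Fin n) E) (β : Matrix (Fin n) (Fin m) ℂ) :
    Matrix (Fin m) (Fin m) E :=
  Matrix.of fun i j => ∑ k, ∑ l, (α i k * β l j) • x k l

/-- The block-diagonal matrix `x ⊕ y ∈ M_{m+n}(E)`. -/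
def matDirectSum {E : Type*} [AddCommGroup E] {m n : ℕ}
    (x : Matrix (Fin m) (Fin m) E) (y : Matrix (Fin n) (Fin n) E) :
    Matrix (Fin (m + n)) (Fin (m + n)) E :=
  (Matrix.fromBlocks x 0 0 y).reindex finSumFinEquiv finSumFinEquiv

/-- An (abstract) operator space in the sense of Ruan: a complex normed space `E` with norms on
all the matrix spaces `M_n(E)` which extend the norm of `E = M_1(E)` and satisfy Ruan's axioms
`‖α x β‖ ≤ ‖α‖ ‖x‖ ‖β‖` and `‖x ⊕ y‖ ≤ max ‖x‖ ‖y‖` (the opposite inequality in the latter follows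
from the former). The norm of a scalar matrix is its operator norm between Euclidean spaces.
Completeness of `E` is not required. -/
class OperatorSpace (E : Type*) [NormedAddCommGroup E] [NormedSpace ℂ E] where
  /-- The norm of `M_n(E)`. -/
  mnorm : ∀ {n : ℕ}, Matrix (Fin n) (Fin n) E → ℝ
  mnorm_add_le : ∀ {n : ℕ} (x y : Matrix (Fin n) (Fin n) E), mnorm (x + y) ≤ mnorm x + mnorm y
  mnorm_smul : ∀ {n : ℕ} (c : ℂ) (x : Matrix (Fin n) (Fin n) E), mnorm (c • x) = ‖c‖ * mnorm x
  mnorm_one : ∀ a : E, mnorm (Matrix.of fun _ _ : Fin 1 => a) = ‖a‖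
  mnorm_bimul_le : ∀ {m n : ℕ} (α : Matrix (Fin m) (Fin n) ℂ) (x : Matrix (Fin n) (Fin n) E)
    (β : Matrix (Fin n) (Fin m) ℂ), mnorm (matBimul α x β) ≤ ‖α‖ * mnorm x * ‖β‖
  mnorm_directSum_le : ∀ {m n : ℕ} (x : Matrix (Fin m) (Fin m) E) (y : Matrix (Fin n) (Fin n) E),
    mnorm (matDirectSum x y) ≤ max (mnorm x) (mnorm y)

open OperatorSpace

/-! ### Completely bounded maps and the uniform approximation property -/

/-- The completely bounded norm `‖T‖_cb = sup_n ‖id ⊗ T : M_n(E) → M_n(F)‖`, with values in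
`[0, ∞]`. -/
def cbNorm {E F : Type*} [NormedAddCommGroup E] [NormedSpace ℂ E] [OperatorSpace E]
    [NormedAddCommGroup F] [NormedSpace ℂ F] [OperatorSpace F] (T : E →ₗ[ℂ] F) : ℝ≥0∞ :=
  ⨆ (n : ℕ) (x : Matrix (Fin n) (Fin n) E) (_ : mnorm x ≤ 1), ENNReal.ofReal (mnorm (x.map T))

/-- `T ∈ CB(E, F)`. -/
def IsCompletelyBounded {E F : Type*} [NormedAddCommGroup E] [NormedSpace ℂ E] [OperatorSpace E]
    [NormedAddCommGroup F] [NormedSpace ℂ F] [OperatorSpace F] (T : E →ₗ[ℂ] F) : Prop :=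
  cbNorm T < ∞

/-- The `(K, k(n))`-OUAP of an operator space `E`. -/
def HasOUAP (K : ℝ) (k : ℕ → ℝ) (E : Type*) [NormedAddCommGroup E] [NormedSpace ℂ E]
    [OperatorSpace E] : Prop :=
  ∀ (n : ℕ) (M : Submodule ℂ E), FiniteDimensional ℂ M → Module.finrank ℂ M = n →
    ∃ T : E →ₗ[ℂ] E, IsCompletelyBounded T ∧ FiniteDimensional ℂ (LinearMap.range T) ∧
      cbNorm T ≤ ENNReal.ofReal K ∧ (Module.finrank ℂ (LinearMap.range T) : ℝ) ≤ k n ∧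
      ∀ x ∈ M, T x = x

/-! ### Elementary consequences of the axioms -/

section Basic

variable {E : Type*} [NormedAddCommGroup E] [NormedSpace ℂ E] [OperatorSpace E]

theorem mnorm_zero {n : ℕ} : mnorm (0 : Matrix (Fin n) (Fin n) E) = 0 := by
  have := mnorm_smul (0 : ℂ) (0 : Matrix (Fin n) (Fin n) E)
  simpa using this

theorem mnorm_neg {n : ℕ} (x : Matrix (Fin n) (Fin n) E) : mnorm (-x) = mnorm x := by
  have := mnorm_smul (-1 : ℂ) x
  simpa using this

theorem mnorm_nonneg {n : ℕ} (x : Matrix (Fin n) (Fin n) E) : 0 ≤ mnorm x := by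
  have h := mnorm_add_le x (-x)
  rw [add_neg_cancel, mnorm_zero, mnorm_neg] at h
  linarith

theorem abs_mnorm_sub_le {n : ℕ} (x y : Matrix (Fin n) (Fin n) E) :
    |mnorm x - mnorm y| ≤ mnorm (x - y) := by
  have h1 := mnorm_add_le (x - y) y
  have h2 := mnorm_add_le (-(x - y)) x
  rw [mnorm_neg] at h2
  have e1 : x - y + y = x := by abel
  have e2 : -(x - y) + x = y := by abel
  rw [e1] at h1
  rw [e2] at h2
  rw [abs_le]
  constructor <;> linarith

theorem mnorm_sum_le {n : ℕ} {ι : Type*} (s : Finset ι) (f : ι → Matrix (Fin n) (Fin n) E) :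
    mnorm (∑ i ∈ s, f i) ≤ ∑ i ∈ s, mnorm (f i) := by
  classical
  induction s using Finset.induction_on with
  | empty => simp [mnorm_zero]
  | insert a s ha ih =>
    rw [Finset.sum_insert ha, Finset.sum_insert ha]
    exact (mnorm_add_le _ _).trans (by linarith)

/-! ### Operator norms of scalar matrices -/

theorem scalar_mulVec_le {ι κ : Type*} [Fintype ι] [Fintype κ] [DecidableEq κ]
    (A : Matrix ι κ ℂ) (v : κ → ℂ) :
    ‖WithLp.toLp 2 (A.mulVec v)‖ ≤ ‖A‖ * ‖WithLp.toLp 2 v‖ :=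
  Matrix.l2_opNorm_mulVec A (WithLp.toLp 2 v)

theorem scalar_norm_le {ι κ : Type*} [Fintype ι] [Fintype κ] [DecidableEq κ]
    (A : Matrix ι κ ℂ) {C : ℝ} (hC : 0 ≤ C)
    (h : ∀ v : κ → ℂ, ‖WithLp.toLp 2 (A.mulVec v)‖ ≤ C * ‖WithLp.toLp 2 v‖) : ‖A‖ ≤ C := by
  rw [Matrix.l2_opNorm_def]
  refine ContinuousLinearMap.opNorm_le_bound _ hC fun v => ?_
  exact h v.ofLp

theorem norm_dotProduct_le {ι : Type*} [Fintype ι] (w v : ι → ℂ) :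
    ‖w ⬝ᵥ v‖ ≤ ‖WithLp.toLp 2 w‖ * ‖WithLp.toLp 2 v‖ := by
  have h := norm_inner_le_norm (𝕜 := ℂ) (WithLp.toLp 2 (star w)) (WithLp.toLp 2 v)
  have e : inner ℂ (WithLp.toLp 2 (star w)) (WithLp.toLp 2 v) = w ⬝ᵥ v := by
    simp [PiLp.inner_apply, dotProduct, mul_comm]
  rw [e] at h
  refine h.trans (le_of_eq ?_)
  simp [EuclideanSpace.norm_eq]

theorem scalar_bilin_le {ι κ : Type*} [Fintype ι] [Fintype κ] [DecidableEq κ]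
    (A : Matrix ι κ ℂ) (w : ι → ℂ) (v : κ → ℂ) :
    ‖w ⬝ᵥ A.mulVec v‖ ≤ ‖A‖ * (‖WithLp.toLp 2 w‖ * ‖WithLp.toLp 2 v‖) := by
  refine (norm_dotProduct_le _ _).trans ?_
  have := mul_le_mul_of_nonneg_left (scalar_mulVec_le A v) (norm_nonneg (WithLp.toLp 2 w))
  linarith

theorem scalar_norm_le_of_bilin {ι κ : Type*} [Fintype ι] [Fintype κ] [DecidableEq κ]
    (A : Matrix ι κ ℂ) {C : ℝ} (hC : 0 ≤ C)
    (h : ∀ (w : ι → ℂ) (v : κ → ℂ),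
      ‖w ⬝ᵥ A.mulVec v‖ ≤ C * (‖WithLp.toLp 2 w‖ * ‖WithLp.toLp 2 v‖)) : ‖A‖ ≤ C := by
  refine scalar_norm_le A hC fun v => ?_
  set u := A.mulVec v with hu
  have h1 := h (star u) v
  have e : star u ⬝ᵥ u = ((‖WithLp.toLp 2 u‖ ^ 2 : ℝ) : ℂ) := by
    have := inner_self_eq_norm_sq_to_K (𝕜 := ℂ) (WithLp.toLp 2 u)
    rw [← hu] at *
    simp only [PiLp.inner_apply, RCLike.inner_apply] at this
    simp only [dotProduct, Pi.star_apply, RCLike.star_def]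
    rw [Complex.ofReal_pow]
    rw [← Complex.coe_algebraMap, ← this]
    exact Finset.sum_congr rfl fun i _ => mul_comm _ _
  have e2 : ‖WithLp.toLp 2 (star u)‖ = ‖WithLp.toLp 2 u‖ := by simp [EuclideanSpace.norm_eq]
  rw [← hu, e, e2, Complex.norm_real, Real.norm_of_nonneg (by positivity)] at h1
  rcases (norm_nonneg (WithLp.toLp 2 u)).eq_or_lt with h0 | h0
  · rw [← h0]; positivity
  · by_contra hlt
    push Not at hlt
    nlinarith

theorem scalar_row_norm_le {m : ℕ} (w : Fin m → ℂ) :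
    ‖(Matrix.of fun (_ : Fin 1) j => w j)‖ ≤ ‖WithLp.toLp 2 w‖ := by
  refine scalar_norm_le _ (norm_nonneg _) fun v => ?_
  refine le_trans (le_of_eq ?_) (norm_dotProduct_le w v)
  simp [EuclideanSpace.norm_eq, Matrix.mulVec]

theorem scalar_col_norm_le {m : ℕ} (w : Fin m → ℂ) :
    ‖(Matrix.of fun i (_ : Fin 1) => w i)‖ ≤ ‖WithLp.toLp 2 w‖ := by
  refine scalar_norm_le _ (norm_nonneg _) fun v => le_of_eq ?_
  have : (Matrix.of fun i (_ : Fin 1) => w i).mulVec v = v 0 • w := by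
    ext i; simp [Matrix.mulVec, dotProduct, mul_comm]
  rw [this, WithLp.toLp_smul, norm_smul, mul_comm]
  congr 1
  simp [EuclideanSpace.norm_eq]

theorem scalar_kronecker_one_le {m n p : ℕ} (α : Matrix (Fin m) (Fin n) ℂ) :
    ‖Matrix.kronecker α (1 : Matrix (Fin p) (Fin p) ℂ)‖ ≤ ‖α‖ := by
  refine scalar_norm_le _ (norm_nonneg _) fun v => ?_
  rw [← sq_le_sq₀ (norm_nonneg _) (by positivity), mul_pow, EuclideanSpace.norm_sq_eq,
    EuclideanSpace.norm_sq_eq, Fintype.sum_prod_type_right, Fintype.sum_prod_type_right,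
    Finset.mul_sum]
  refine Finset.sum_le_sum fun a _ => ?_
  have h := scalar_mulVec_le α (fun i => v (i, a))
  rw [← sq_le_sq₀ (norm_nonneg _) (by positivity), mul_pow, EuclideanSpace.norm_sq_eq,
    EuclideanSpace.norm_sq_eq] at h
  refine le_trans (le_of_eq ?_) h
  refine Finset.sum_congr rfl fun i _ => ?_
  congr 2
  simp [Matrix.mulVec, dotProduct, Fintype.sum_prod_type, Matrix.one_apply]

/-- `mnorm` is dominated by the sum of the norms of the entries. -/
theorem mnorm_le_sum_norm {n : ℕ} (x : Matrix (Fin n) (Fin n) E) :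
    mnorm x ≤ ∑ i, ∑ j, ‖x i j‖ := by
  have hx : x = ∑ i, ∑ j, matBimul (Matrix.of fun k (_ : Fin 1) => (Pi.single i 1 : Fin n → ℂ) k)
      (Matrix.of fun _ _ : Fin 1 => x i j)
      (Matrix.of fun (_ : Fin 1) k => (Pi.single j 1 : Fin n → ℂ) k) := by
    ext a b
    simp only [Matrix.sum_apply]
    simp only [matBimul, Matrix.of_apply, Finset.univ_unique, Finset.sum_const,
      Finset.card_singleton, one_smul]
    simp [Pi.single_apply, mul_comm, ite_smul, ← ite_and]
    simp [ite_and]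
  conv_lhs => rw [hx]
  refine (mnorm_sum_le _ _).trans (Finset.sum_le_sum fun i _ => ?_)
  refine (mnorm_sum_le _ _).trans (Finset.sum_le_sum fun j _ => ?_)
  refine (mnorm_bimul_le _ _ _).trans ?_
  rw [mnorm_one]
  have h1 := scalar_col_norm_le (Pi.single i 1 : Fin n → ℂ)
  have h2 := scalar_row_norm_le (Pi.single j 1 : Fin n → ℂ)
  have e1 : ‖WithLp.toLp 2 (Pi.single i 1 : Fin n → ℂ)‖ = 1 := by simp
  have e2 : ‖WithLp.toLp 2 (Pi.single j 1 : Fin n → ℂ)‖ = 1 := by simp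
  rw [e1] at h1
  rw [e2] at h2
  calc _ ≤ 1 * ‖x i j‖ * 1 := by gcongr
    _ = _ := by ring

end Basic

/-! ### The dual operator space -/

section Dual

variable {E : Type*} [NormedAddCommGroup E] [NormedSpace ℂ E]

/-- The scalar matrix `[φ_ij(x_kl)]`, of size `nm`, for `φ ∈ M_n(E*)` and `x ∈ M_m(E)`. -/
def dualPairing {n m : ℕ} (φ : Matrix (Fin n) (Fin n) (StrongDual ℂ E))
    (x : Matrix (Fin m) (Fin m) E) : Matrix (Fin n × Fin m) (Fin n × Fin m) ℂ :=
  Matrix.of fun p q => φ p.1 q.1 (x p.2 q.2)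

theorem dualPairing_bimul {n n' m : ℕ} (α : Matrix (Fin n') (Fin n) ℂ)
    (φ : Matrix (Fin n) (Fin n) (StrongDual ℂ E)) (β : Matrix (Fin n) (Fin n') ℂ)
    (x : Matrix (Fin m) (Fin m) E) :
    dualPairing (matBimul α φ β) x =
      Matrix.kronecker α (1 : Matrix (Fin m) (Fin m) ℂ) * dualPairing φ x *
        Matrix.kronecker β (1 : Matrix (Fin m) (Fin m) ℂ) := by
  ext ⟨i, a⟩ ⟨j, b⟩
  simp only [dualPairing, matBimul, Matrix.of_apply, Matrix.mul_apply, Fintype.sum_prod_type,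
    Matrix.kronecker, Matrix.kroneckerMap_apply, Matrix.one_apply]
  simp [Finset.sum_mul]
  rw [Finset.sum_comm]
  refine Finset.sum_congr rfl fun l _ => Finset.sum_congr rfl fun k _ => ?_
  ring

theorem dualPairing_directSum {n n' m : ℕ} (φ : Matrix (Fin n) (Fin n) (StrongDual ℂ E))
    (ψ : Matrix (Fin n') (Fin n') (StrongDual ℂ E)) (x : Matrix (Fin m) (Fin m) E) :
    ‖dualPairing (matDirectSum φ ψ) x‖ ≤ max ‖dualPairing φ x‖ ‖dualPairing ψ x‖ := by
  set C := max ‖dualPairing φ x‖ ‖dualPairing ψ x‖ with hC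
  have hC0 : 0 ≤ C := (norm_nonneg _).trans (le_max_left _ _)
  refine scalar_norm_le _ hC0 fun v => ?_
  let v1 : Fin n × Fin m → ℂ := fun p => v (Fin.castAdd n' p.1, p.2)
  let v2 : Fin n' × Fin m → ℂ := fun p => v (Fin.natAdd n p.1, p.2)
  have hsplit : ∀ u : Fin (n + n') × Fin m → ℂ, ‖WithLp.toLp 2 u‖ ^ 2 =
      ‖WithLp.toLp 2 (fun p : Fin n × Fin m => u (Fin.castAdd n' p.1, p.2))‖ ^ 2 +
      ‖WithLp.toLp 2 (fun p : Fin n' × Fin m => u (Fin.natAdd n p.1, p.2))‖ ^ 2 := by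
    intro u
    simp only [EuclideanSpace.norm_sq_eq, Fintype.sum_prod_type]
    rw [Fin.sum_univ_add]
  have e1 : (fun p : Fin n × Fin m => (dualPairing (matDirectSum φ ψ) x).mulVec v
      (Fin.castAdd n' p.1, p.2)) = (dualPairing φ x).mulVec v1 := by
    ext ⟨i, a⟩
    simp [Matrix.mulVec, dotProduct, Fintype.sum_prod_type, dualPairing, matDirectSum,
      Fin.sum_univ_add, v1]
  have e2 : (fun p : Fin n' × Fin m => (dualPairing (matDirectSum φ ψ) x).mulVec v
      (Fin.natAdd n p.1, p.2)) = (dualPairing ψ x).mulVec v2 := by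
    ext ⟨i, a⟩
    simp [Matrix.mulVec, dotProduct, Fintype.sum_prod_type, dualPairing, matDirectSum,
      Fin.sum_univ_add, v2]
  rw [← sq_le_sq₀ (norm_nonneg _) (by positivity), mul_pow, hsplit, hsplit v, e1, e2, mul_add]
  have h1 := (scalar_mulVec_le (dualPairing φ x) v1).trans
    (mul_le_mul_of_nonneg_right (le_max_left _ ‖dualPairing ψ x‖) (norm_nonneg _))
  have h2 := (scalar_mulVec_le (dualPairing ψ x) v2).trans
    (mul_le_mul_of_nonneg_right (le_max_right ‖dualPairing φ x‖ _) (norm_nonneg _))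
  rw [← hC, ← sq_le_sq₀ (norm_nonneg _) (by positivity), mul_pow] at h1 h2
  exact add_le_add h1 h2

variable [OperatorSpace E]

variable (E) in
/-- The elements of the closed unit balls of all the spaces `M_m(E)`. -/
abbrev MatrixBall : Type _ := Σ m : ℕ, {x : Matrix (Fin m) (Fin m) E // mnorm x ≤ 1}

/-- The dual matrix norms, given by `M_n(E*) = CB(E, M_n)`: the norm of `φ` is the completely
bounded norm of the map `x ↦ [φ_ij(x)]`. -/
def dualMnorm {n : ℕ} (φ : Matrix (Fin n) (Fin n) (StrongDual ℂ E)) : ℝ :=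
  ⨆ p : MatrixBall E, ‖dualPairing φ p.2.1‖

instance : Nonempty (MatrixBall E) := ⟨⟨0, 0, by rw [mnorm_zero]; norm_num⟩⟩

theorem norm_dualPairing_le {n m : ℕ} (φ : Matrix (Fin n) (Fin n) (StrongDual ℂ E))
    (x : Matrix (Fin m) (Fin m) E) (hx : mnorm x ≤ 1) :
    ‖dualPairing φ x‖ ≤ ∑ i, ∑ j, ‖φ i j‖ := by
  refine scalar_norm_le_of_bilin _ (by positivity) fun w v => ?_
  have key : w ⬝ᵥ (dualPairing φ x).mulVec v =
      ∑ i, ∑ j, φ i j (∑ k, ∑ l, (w (i, k) * v (j, l)) • x k l) := by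
    simp only [dotProduct, Matrix.mulVec, dualPairing, Matrix.of_apply, Fintype.sum_prod_type,
      map_sum, map_smul, smul_eq_mul, Finset.mul_sum]
    refine Finset.sum_congr rfl fun i _ => ?_
    rw [Finset.sum_comm]
    refine Finset.sum_congr rfl fun j _ => Finset.sum_congr rfl fun k _ =>
      Finset.sum_congr rfl fun l _ => ?_
    ring
  rw [key, Finset.sum_mul]
  refine (norm_sum_le _ _).trans (Finset.sum_le_sum fun i _ => ?_)
  rw [Finset.sum_mul]
  refine (norm_sum_le _ _).trans (Finset.sum_le_sum fun j _ => ?_)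
  refine (ContinuousLinearMap.le_opNorm _ _).trans ?_
  refine mul_le_mul_of_nonneg_left ?_ (norm_nonneg _)
  have hsub : ∀ (u : Fin n × Fin m → ℂ) (i : Fin n),
      ‖WithLp.toLp 2 (fun k => u (i, k))‖ ≤ ‖WithLp.toLp 2 u‖ := by
    intro u i
    rw [← sq_le_sq₀ (norm_nonneg _) (norm_nonneg _), EuclideanSpace.norm_sq_eq,
      EuclideanSpace.norm_sq_eq, Fintype.sum_prod_type]
    exact Finset.single_le_sum (f := fun i => ∑ k, ‖u (i, k)‖ ^ 2)
      (fun i _ => Finset.sum_nonneg fun k _ => by positivity) (Finset.mem_univ i)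
  have h := mnorm_bimul_le (Matrix.of fun (_ : Fin 1) k => w (i, k)) x
    (Matrix.of fun l (_ : Fin 1) => v (j, l))
  have e : matBimul (Matrix.of fun (_ : Fin 1) k => w (i, k)) x
      (Matrix.of fun l (_ : Fin 1) => v (j, l)) =
      Matrix.of fun _ _ => ∑ k, ∑ l, (w (i, k) * v (j, l)) • x k l := rfl
  rw [e, mnorm_one] at h
  refine h.trans ?_
  have h1 := (scalar_row_norm_le fun k => w (i, k)).trans (hsub w i)
  have h2 := (scalar_col_norm_le fun k => v (j, k)).trans (hsub v j)
  have h0 := mnorm_nonneg x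
  calc _ ≤ ‖WithLp.toLp 2 w‖ * 1 * ‖WithLp.toLp 2 v‖ := by gcongr
    _ = _ := by ring

theorem bddAbove_dualPairing {n : ℕ} (φ : Matrix (Fin n) (Fin n) (StrongDual ℂ E)) :
    BddAbove (Set.range fun p : MatrixBall E => ‖dualPairing φ p.2.1‖) := by
  refine ⟨∑ i, ∑ j, ‖φ i j‖, ?_⟩
  rintro _ ⟨p, rfl⟩
  exact norm_dualPairing_le φ p.2.1 p.2.2

theorem norm_dualPairing_le_dualMnorm {n : ℕ} (φ : Matrix (Fin n) (Fin n) (StrongDual ℂ E))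
    (p : MatrixBall E) : ‖dualPairing φ p.2.1‖ ≤ dualMnorm φ :=
  le_ciSup (bddAbove_dualPairing φ) p

theorem dualMnorm_nonneg {n : ℕ} (φ : Matrix (Fin n) (Fin n) (StrongDual ℂ E)) :
    0 ≤ dualMnorm φ := Real.iSup_nonneg fun _ => norm_nonneg _

theorem norm_apply_le_dualMnorm (f : StrongDual ℂ E) (a : E) :
    ‖f a‖ ≤ dualMnorm (Matrix.of fun _ _ : Fin 1 => f) * ‖a‖ := by
  have hunit : ∀ b : E, ‖b‖ ≤ 1 → ‖f b‖ ≤ dualMnorm (Matrix.of fun _ _ : Fin 1 => f) := by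
    intro b hb
    have h := norm_dualPairing_le_dualMnorm (Matrix.of fun _ _ : Fin 1 => f)
      ⟨1, Matrix.of fun _ _ => b, by rw [mnorm_one]; exact hb⟩
    have h2 := scalar_bilin_le (dualPairing (Matrix.of fun _ _ : Fin 1 => f)
      (Matrix.of fun _ _ : Fin 1 => b)) (fun _ => 1) (fun _ => 1)
    refine le_trans ?_ h
    simpa [dualPairing, dotProduct, Matrix.mulVec, EuclideanSpace.norm_eq] using h2
  rcases eq_or_ne a 0 with rfl | ha
  · simp
  · have hpos : 0 < ‖a‖ := norm_pos_iff.2 ha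
    have h := hunit (((‖a‖⁻¹ : ℝ) : ℂ) • a) (by
      rw [norm_smul, Complex.norm_real, norm_inv, norm_norm, inv_mul_cancel₀ hpos.ne'])
    rw [map_smul, norm_smul, Complex.norm_real, norm_inv, norm_norm] at h
    rwa [inv_mul_le_iff₀ hpos, mul_comm] at h

/-- The standard operator space structure on the dual of an operator space. -/
instance dualOperatorSpace : OperatorSpace (StrongDual ℂ E) where
  mnorm φ := dualMnorm φ
  mnorm_add_le φ ψ := by
    refine ciSup_le fun p => ?_
    have : dualPairing (φ + ψ) p.2.1 = dualPairing φ p.2.1 + dualPairing ψ p.2.1 := by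
      ext; simp [dualPairing]
    rw [this]
    exact (norm_add_le _ _).trans (add_le_add (norm_dualPairing_le_dualMnorm φ p)
      (norm_dualPairing_le_dualMnorm ψ p))
  mnorm_smul c φ := by
    have : ∀ p : MatrixBall E, ‖dualPairing (c • φ) p.2.1‖ = ‖c‖ * ‖dualPairing φ p.2.1‖ := by
      intro p
      rw [← norm_smul]
      congr 1
    simp only [dualMnorm, this]
    rw [Real.mul_iSup_of_nonneg (norm_nonneg _)]
  mnorm_one f := by
    refine le_antisymm (ciSup_le fun p => ?_) ?_
    · simpa using norm_dualPairing_le (Matrix.of fun _ _ : Fin 1 => f) p.2.1 p.2.2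
    · exact ContinuousLinearMap.opNorm_le_bound _ (dualMnorm_nonneg _)
        fun a => norm_apply_le_dualMnorm f a
  mnorm_bimul_le α φ β := by
    refine ciSup_le fun p => ?_
    rw [dualPairing_bimul]
    refine (Matrix.l2_opNorm_mul _ _).trans ?_
    have h0 := norm_dualPairing_le_dualMnorm φ p
    have h1 := scalar_kronecker_one_le (p := p.1) α
    have h2 := scalar_kronecker_one_le (p := p.1) β
    have h3 := Matrix.l2_opNorm_mul (Matrix.kronecker α (1 : Matrix (Fin p.1) (Fin p.1) ℂ))
      (dualPairing φ p.2.1)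
    have h4 := dualMnorm_nonneg φ
    calc _ ≤ (‖Matrix.kronecker α (1 : Matrix (Fin p.1) (Fin p.1) ℂ)‖ * ‖dualPairing φ p.2.1‖) *
          ‖Matrix.kronecker β (1 : Matrix (Fin p.1) (Fin p.1) ℂ)‖ := by gcongr
      _ ≤ _ := by gcongr
  mnorm_directSum_le φ ψ := by
    refine ciSup_le fun p => ?_
    exact (dualPairing_directSum φ ψ p.2.1).trans (max_le_max (norm_dualPairing_le_dualMnorm φ p)
      (norm_dualPairing_le_dualMnorm ψ p))

end Dual

/-! ### Ultraproducts -/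

section Ultraproduct

variable {ι : Type u} (U : Ultrafilter ι) (E : ι → Type v) [∀ i, NormedAddCommGroup (E i)]
  [∀ i, NormedSpace ℂ (E i)]

/-- The bounded families `(x_i)` with `lim_U ‖x_i‖ = 0`. -/
def ultraNull : Submodule ℂ (lp E ∞) where
  carrier := {x | Tendsto (fun i => ‖x i‖) U (𝓝 0)}
  zero_mem' := by simp
  add_mem' {x y} hx hy := by
    refine squeeze_zero (fun i => norm_nonneg _) (fun i => norm_add_le (x i) (y i)) ?_
    simpa using Tendsto.add hx hy
  smul_mem' c x hx := by
    have : Tendsto (fun i => ‖c‖ * ‖x i‖) U (𝓝 (‖c‖ * 0)) := Tendsto.const_mul _ hx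
    simpa [norm_smul] using this

instance ultraNull_isClosed : IsClosed (ultraNull U E : Set (lp E ∞)) := by
  refine isClosed_of_closure_subset fun x hx => ?_
  show Tendsto (fun i => ‖x i‖) U (𝓝 0)
  rw [Metric.tendsto_nhds]
  intro ε hε
  obtain ⟨y, hy, hxy⟩ := Metric.mem_closure_iff.1 hx (ε / 2) (by positivity)
  have hy' : Tendsto (fun i => ‖y i‖) U (𝓝 0) := hy
  filter_upwards [(Metric.tendsto_nhds.1 hy') (ε / 2) (by positivity)] with i hi
  have h1 : ‖x i - y i‖ ≤ ‖x - y‖ := lp.norm_apply_le_norm ENNReal.top_ne_zero (x - y) i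
  rw [dist_eq_norm] at hxy
  have h2 := norm_le_norm_add_norm_sub (y i) (x i)
  rw [norm_sub_rev] at h2
  simp only [dist_zero_right, norm_norm] at hi ⊢
  linarith

/-- The ultraproduct `∏ E_i / U`: the quotient of the `ℓ^∞`-direct sum of the `E_i` by the closed
subspace of the families with `lim_U ‖x_i‖ = 0`, with the quotient norm. -/
abbrev Ultraproduct : Type (max u v) := lp E ∞ ⧸ ultraNull U E

variable {U E}

theorem exists_tendsto_of_bounded {f : ι → ℝ} {C : ℝ} (h0 : ∀ i, 0 ≤ f i) (hC : ∀ i, f i ≤ C) :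
    ∃ L, Tendsto f U (𝓝 L) := by
  obtain ⟨L, -, hL⟩ := isCompact_Icc.ultrafilter_le_nhds (U.map f)
    (s := Set.Icc 0 C) (by
      rw [le_principal_iff]
      exact Filter.mem_map.2 (Filter.univ_mem' fun i => ⟨h0 i, hC i⟩))
  exact ⟨L, hL⟩

theorem coe_sum_apply {κ : Type*} (s : Finset κ) (f : κ → lp E ∞) (i : ι) :
    (∑ k ∈ s, f k) i = ∑ k ∈ s, f k i := by
  rw [lp.coeFn_sum, Finset.sum_apply]

theorem exists_lift {n : ℕ} (X : Matrix (Fin n) (Fin n) (Ultraproduct U E)) :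
    ∃ x : Matrix (Fin n) (Fin n) (lp E ∞),
      x.map (Submodule.Quotient.mk (p := ultraNull U E)) = X := by
  refine ⟨X.map Quotient.out, ?_⟩
  ext k l
  exact Quotient.out_eq (X k l)

/-- The norm of the ultraproduct is `lim_U ‖x_i‖`. -/
theorem tendsto_norm_coord (x : lp E ∞) :
    Tendsto (fun i => ‖x i‖) U (𝓝 ‖(Submodule.Quotient.mk x : Ultraproduct U E)‖) := by
  classical
  obtain ⟨L, hL⟩ := exists_tendsto_of_bounded (U := U) (f := fun i => ‖x i‖) (C := ‖x‖)
    (fun i => norm_nonneg _) fun i => lp.norm_apply_le_norm ENNReal.top_ne_zero x i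
  have hL0 : 0 ≤ L := ge_of_tendsto' hL fun i => norm_nonneg _
  have hle : L ≤ ‖(Submodule.Quotient.mk x : Ultraproduct U E)‖ := by
    refine le_of_forall_pos_le_add fun ε hε => ?_
    obtain ⟨m, hm, hlt⟩ := Submodule.Quotient.norm_mk_lt
      (Submodule.Quotient.mk x : Ultraproduct U E) hε
    have hnull : Tendsto (fun i => ‖(m - x) i‖) U (𝓝 0) := (Submodule.Quotient.eq _).1 hm
    have hadd : Tendsto (fun i => ‖(m - x) i‖ + ‖m‖) U (𝓝 (0 + ‖m‖)) := hnull.add_const _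
    rw [zero_add] at hadd
    refine (le_of_tendsto_of_tendsto' hL hadd fun i => ?_).trans hlt.le
    have h1 := lp.norm_apply_le_norm ENNReal.top_ne_zero m i
    have h2 : ‖x i‖ ≤ ‖m i‖ + ‖(m - x) i‖ := norm_le_norm_add_norm_sub (m i) (x i)
    linarith
  have hge : ‖(Submodule.Quotient.mk x : Ultraproduct U E)‖ ≤ L := by
    refine le_of_forall_pos_le_add fun ε hε => ?_
    have hev : ∀ᶠ i in (U : Filter ι), ‖x i‖ < L + ε :=
      hL.eventually (gt_mem_nhds (by linarith))
    let y0 : ∀ i, E i := fun i => if ‖x i‖ < L + ε then x i else 0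
    have hy0 : ∀ i, ‖y0 i‖ ≤ L + ε := by
      intro i
      by_cases h : ‖x i‖ < L + ε
      · simp only [y0, if_pos h]; exact h.le
      · simp only [y0, if_neg h, norm_zero]; linarith
    let y : lp E ∞ := ⟨y0, memℓp_infty ⟨L + ε, by rintro _ ⟨i, rfl⟩; exact hy0 i⟩⟩
    have hxy : (Submodule.Quotient.mk x : Ultraproduct U E) = Submodule.Quotient.mk y := by
      rw [Submodule.Quotient.eq]
      refine tendsto_const_nhds.congr' ?_
      filter_upwards [hev] with i hi
      have : (x - y) i = x i - y0 i := rfl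
      rw [this]
      simp [y0, hi]
    rw [hxy]
    exact (Submodule.Quotient.norm_mk_le _ y).trans
      (lp.norm_le_of_forall_le (by linarith) hy0)
  rwa [le_antisymm hle hge] at hL

variable [∀ i, OperatorSpace (E i)]

/-- The `i`-th coordinate in `M_n(E_i)` of a matrix of bounded families. -/
def coordMatrix {n : ℕ} (x : Matrix (Fin n) (Fin n) (lp E ∞)) (i : ι) :
    Matrix (Fin n) (Fin n) (E i) :=
  Matrix.of fun k l => x k l i

/-- The matrix norms of the ultraproduct: `‖X‖ = lim_U ‖x_i‖`, where `x_i ∈ M_n(E_i)` and `(x_i)`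
represents `X` (see `tendsto_mnorm_coord` for the independence of the representative). -/
def ultraMnorm {n : ℕ} (X : Matrix (Fin n) (Fin n) (Ultraproduct U E)) : ℝ :=
  limUnder (U : Filter ι) fun i => mnorm (coordMatrix (X.map Quotient.out) i)

theorem exists_tendsto_mnorm {n : ℕ} (x : Matrix (Fin n) (Fin n) (lp E ∞)) :
    ∃ L, Tendsto (fun i => mnorm (coordMatrix x i)) U (𝓝 L) := by
  refine exists_tendsto_of_bounded (C := ∑ k, ∑ l, ‖x k l‖) (fun i => mnorm_nonneg _) fun i => ?_
  refine (mnorm_le_sum_norm _).trans ?_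
  exact Finset.sum_le_sum fun k _ => Finset.sum_le_sum fun l _ =>
    lp.norm_apply_le_norm ENNReal.top_ne_zero (x k l) i

/-- The matrix norms of the ultraproduct may be computed with any representative. -/
theorem tendsto_mnorm_coord {n : ℕ} (x : Matrix (Fin n) (Fin n) (lp E ∞)) :
    Tendsto (fun i => mnorm (coordMatrix x i)) U
      (𝓝 (ultraMnorm (x.map (Submodule.Quotient.mk (p := ultraNull U E))))) := by
  set X : Matrix (Fin n) (Fin n) (Ultraproduct U E) := x.map Submodule.Quotient.mk with hX
  set y : Matrix (Fin n) (Fin n) (lp E ∞) := X.map Quotient.out with hy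
  have hlim : Tendsto (fun i => mnorm (coordMatrix y i)) U (𝓝 (ultraMnorm X)) :=
    tendsto_nhds_limUnder (exists_tendsto_mnorm y)
  have hnull : ∀ k l, x k l - y k l ∈ ultraNull U E := by
    intro k l
    rw [← Submodule.Quotient.eq]
    exact (Quotient.out_eq (X k l)).symm
  have hz : Tendsto (fun i => ∑ k, ∑ l, ‖(x k l - y k l) i‖) U (𝓝 0) := by
    have : Tendsto (fun i => ∑ k : Fin n, ∑ l : Fin n, ‖(x k l - y k l) i‖) U
        (𝓝 (∑ _k : Fin n, ∑ _l : Fin n, (0 : ℝ))) :=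
      tendsto_finsetSum _ fun k _ => tendsto_finsetSum _ fun l _ => hnull k l
    simpa using this
  have hd : Tendsto (fun i => mnorm (coordMatrix x i) - mnorm (coordMatrix y i)) U (𝓝 0) := by
    refine squeeze_zero_norm (fun i => ?_) hz
    rw [Real.norm_eq_abs]
    refine (abs_mnorm_sub_le _ _).trans ((mnorm_le_sum_norm _).trans (le_of_eq ?_))
    rfl
  simpa using hd.add hlim

/-- The operator space structure on an ultraproduct of operator spaces. -/
instance ultraproductOperatorSpace : OperatorSpace (Ultraproduct U E) where
  mnorm X := ultraMnorm X
  mnorm_add_le X Y := by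
    obtain ⟨x, rfl⟩ := exists_lift X
    obtain ⟨y, rfl⟩ := exists_lift Y
    have h : Tendsto (fun i => mnorm (coordMatrix (x + y) i)) U (𝓝 (ultraMnorm
        (x.map (Submodule.Quotient.mk (p := ultraNull U E)) +
          y.map (Submodule.Quotient.mk (p := ultraNull U E))))) :=
      tendsto_mnorm_coord (x + y)
    exact le_of_tendsto_of_tendsto' h ((tendsto_mnorm_coord x).add (tendsto_mnorm_coord y))
      fun i => mnorm_add_le (coordMatrix x i) (coordMatrix y i)
  mnorm_smul c X := by
    obtain ⟨x, rfl⟩ := exists_lift X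
    have h : Tendsto (fun i => mnorm (coordMatrix (c • x) i)) U (𝓝 (ultraMnorm
        (c • x.map (Submodule.Quotient.mk (p := ultraNull U E))))) :=
      tendsto_mnorm_coord (c • x)
    refine tendsto_nhds_unique h (((tendsto_mnorm_coord x).const_mul ‖c‖).congr fun i => ?_)
    exact (mnorm_smul c (coordMatrix x i)).symm
  mnorm_one a := by
    obtain ⟨x, rfl⟩ := Submodule.Quotient.mk_surjective _ a
    have h : Tendsto (fun i => mnorm (coordMatrix (Matrix.of fun _ _ : Fin 1 => x) i)) U
        (𝓝 (ultraMnorm (Matrix.of fun _ _ : Fin 1 =>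
          (Submodule.Quotient.mk x : Ultraproduct U E)))) :=
      tendsto_mnorm_coord (Matrix.of fun _ _ : Fin 1 => x)
    refine tendsto_nhds_unique h ((tendsto_norm_coord x).congr fun i => ?_)
    exact (mnorm_one (x i)).symm
  mnorm_bimul_le α X β := by
    obtain ⟨x, rfl⟩ := exists_lift X
    have e : (matBimul α x β).map (Submodule.Quotient.mk (p := ultraNull U E)) =
        matBimul α (x.map (Submodule.Quotient.mk (p := ultraNull U E))) β := by
      ext a b
      show (ultraNull U E).mkQ _ = _
      simp [matBimul, map_sum]
    have e2 : ∀ i, coordMatrix (matBimul α x β) i = matBimul α (coordMatrix x i) β := by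
      intro i
      ext a b
      simp only [coordMatrix, matBimul, Matrix.of_apply, coe_sum_apply]
      rfl
    have h := tendsto_mnorm_coord (U := U) (matBimul α x β)
    rw [e] at h
    refine le_of_tendsto_of_tendsto' h
      (((tendsto_mnorm_coord x).const_mul ‖α‖).mul_const ‖β‖) fun i => ?_
    rw [e2]
    exact mnorm_bimul_le _ _ _
  mnorm_directSum_le X Y := by
    obtain ⟨x, rfl⟩ := exists_lift X
    obtain ⟨y, rfl⟩ := exists_lift Y
    have e : (matDirectSum x y).map (Submodule.Quotient.mk (p := ultraNull U E)) =
        matDirectSum (x.map (Submodule.Quotient.mk (p := ultraNull U E)))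
          (y.map (Submodule.Quotient.mk (p := ultraNull U E))) := by
      ext a b
      induction a using Fin.addCases <;> induction b using Fin.addCases <;>
        simp [matDirectSum]
    have e2 : ∀ i, coordMatrix (matDirectSum x y) i =
        matDirectSum (coordMatrix x i) (coordMatrix y i) := by
      intro i
      ext a b
      induction a using Fin.addCases <;> induction b using Fin.addCases <;>
        simp [matDirectSum, coordMatrix]
    have h := tendsto_mnorm_coord (U := U) (matDirectSum x y)
    rw [e] at h
    refine le_of_tendsto_of_tendsto' h
      ((tendsto_mnorm_coord x).max (tendsto_mnorm_coord y)) fun i => ?_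
    rw [e2]
    exact mnorm_directSum_le _ _

end Ultraproduct

end OperatorSpaces

end

/-! ### Scalar matrices and positive functionals on `M_n` -/

noncomputable section

section ScalarMatrices

open scoped ENNReal Topology Matrix.Norms.L2Operator ComplexOrder MatrixOrder
open Filter OperatorSpace Matrix

/-! Ultraproducts. Lift a basis of `M` to bounded families. By compactness of the unit sphere of
`ℂ^n`, the coordinates of the lifts are linearly independent in almost every factor
(`eventually_linearIndependent`), so there they span an `n`-dimensional subspace to which the OUAP
applies. The resulting operators `T_i` are uniformly completely bounded and define an operator on
the ultraproduct. It fixes the basis of `M`, its cb-norm is controlled by limits of matrix norms,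
and its rank is at most `k n`, because independent vectors in its range are again independent in
almost every range of `T_i`.

Bidual. The OUAP passes from a space `G` to `F` when there are complete contractions `J : F → G` and
`Q : G → F` with `Q J = id`: use `Q T J`. It therefore suffices to find such maps between `E**` and
an ultrapower of `E`. For `Q` take the weak* limit along the ultrafilter, completely contractive by
lower semicontinuity of the norms of `M_n(E**)`. The map `J` is assembled from linear maps `A : E**
→ E` that keep finitely many matrices in the open unit ball and almost preserve finitely many
pairings with `E*`.

These `A` need no uniform cb bound, so local reflexivity is not required. Direct sums reduce the
problem to a single matrix `X`, and Hahn–Banach reduces that case (`exists_linearMap_mnorm_lt_one`)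
to the fact that a contractive functional `φ` on `M_n(E)` stays contractive on `M_n(E**)`
(`norm_matFunctional_bidual_le`). For the latter, Effros–Ruan convexity
(`exists_dominating_functionals`) dominates `φ` by two positive functionals on `M_n`. Their
densities give `φ = B ψ Dᵀ` with `ψ` in the unit ball of `M_n(E*)` and the Hilbert–Schmidt norms of
`B`, `D` nearly at most one, and such a factorization can be evaluated on `X`. -/

theorem l2_opNorm_transpose_le {m n : ℕ} (A : Matrix (Fin m) (Fin n) ℂ) : ‖Aᵀ‖ ≤ ‖A‖ := by
  refine scalar_norm_le_of_bilin _ (norm_nonneg _) fun w v => ?_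
  have h := scalar_bilin_le A v w
  rw [mulVec_transpose, dotProduct_comm, ← dotProduct_mulVec]
  linarith [mul_comm ‖WithLp.toLp 2 w‖ ‖WithLp.toLp 2 v‖]

theorem re_trace_mul_conjTranspose {ι κ : Type*} [Fintype ι] [Fintype κ] (w : Matrix ι κ ℂ) :
    (w * wᴴ).trace.re = ∑ i, ∑ j, ‖w i j‖ ^ 2 := by
  simp only [trace, diag_apply, mul_apply, conjTranspose_apply, Complex.re_sum]
  refine Finset.sum_congr rfl fun i _ => Finset.sum_congr rfl fun j _ => ?_
  rw [RCLike.star_def, Complex.mul_conj, Complex.ofReal_re, Complex.normSq_eq_norm_sq]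

/-- A linear functional on `M_n` which is nonnegative on the matrices `αᴴ α` is dominated on them
by `α ↦ tr ((α B) (α B)ᴴ)`, for an invertible matrix `B` with `tr (B Bᴴ)` close to the value of the
functional at `1`. -/
theorem exists_invertible_factor {n : ℕ} (p : Matrix (Fin n) (Fin n) ℂ →ₗ[ℂ] ℂ)
    (hp : ∀ α : Matrix (Fin 1) (Fin n) ℂ, 0 ≤ (p (αᴴ * α)).re) {ε : ℝ} (hε : 0 < ε) :
    ∃ B : Matrix (Fin n) (Fin n) ℂ, IsUnit B.det ∧ (B * Bᴴ).trace.re = (p 1).re + ε * n ∧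
      ∀ (m : ℕ) (α : Matrix (Fin m) (Fin n) ℂ),
        (p (αᴴ * α)).re ≤ (α * B * (α * B)ᴴ).trace.re := by
  classical
  -- Density of `p` for the trace pairing.
  let c : Matrix (Fin n) (Fin n) ℂ := of fun l k => p (single k l 1)
  have hc : ∀ P, p P = (c * P).trace := by
    intro P
    conv_lhs => rw [matrix_eq_sum_single P]
    simp only [map_sum, trace, diag_apply, mul_apply]
    rw [Finset.sum_comm]
    refine Finset.sum_congr rfl fun i _ => Finset.sum_congr rfl fun j _ => ?_
    have : single j i (P j i) = P j i • single j i (1 : ℂ) := by simp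
    rw [this, map_smul, smul_eq_mul, mul_comm]
    rfl
  -- Only real parts of values at Hermitian matrices matter, so the density may be replaced by its
  -- Hermitian part.
  let ρ : Matrix (Fin n) (Fin n) ℂ := (1 / 2 : ℂ) • (c + cᴴ)
  have hρ : ∀ P : Matrix (Fin n) (Fin n) ℂ, Pᴴ = P → (ρ * P).trace.re = (p P).re := by
    intro P hP
    have h1 : (cᴴ * P).trace.re = (c * P).trace.re := by
      have : (cᴴ * P).trace = star (c * P).trace := by
        rw [← trace_conjTranspose, conjTranspose_mul, hP, trace_mul_comm]
      rw [this]; simp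
    have h2 : (1 / 2 : ℂ) = ((1 / 2 : ℝ) : ℂ) := by norm_num
    rw [hc]
    simp only [ρ, smul_mul, trace_smul, add_mul, trace_add, smul_eq_mul, h2, Complex.re_ofReal_mul,
      Complex.add_re, h1]
    ring
  have hherm : ρ.IsHermitian := by
    simp only [ρ, IsHermitian, conjTranspose_smul, conjTranspose_add, conjTranspose_conjTranspose]
    rw [add_comm]
    congr 1
    simp
  have hpsd : ρ.PosSemidef := by
    refine .of_dotProduct_mulVec_nonneg hherm fun x => ?_
    have him : (star x ⬝ᵥ ρ *ᵥ x).im = 0 := hherm.im_star_dotProduct_mulVec_self x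
    -- For this row, `αᴴ α` is the rank-one matrix `x xᴴ`.
    have h0 := hp (of fun _ k => star (x k))
    rw [← hρ _ (by simp)] at h0
    have e : (ρ * ((of fun (_ : Fin 1) k => star (x k))ᴴ * (of fun (_ : Fin 1) k => star (x k)))).trace
        = star x ⬝ᵥ ρ *ᵥ x := by
      simp only [trace, diag_apply, mul_apply, dotProduct, mulVec, Finset.mul_sum]
      refine Finset.sum_congr rfl fun i _ => Finset.sum_congr rfl fun j _ => ?_
      simp
      ring
    rw [e] at h0
    rw [Complex.le_def]
    exact ⟨h0, him.symm⟩
  -- The perturbation makes the density invertible, at the cost of `ε * n` in its trace.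
  have hpd : (ρ + (ε : ℂ) • (1 : Matrix (Fin n) (Fin n) ℂ)).PosDef :=
    PosDef.posSemidef_add hpsd (PosDef.one.smul (by exact_mod_cast hε))
  obtain ⟨Y, hY⟩ := CStarAlgebra.nonneg_iff_eq_star_mul_self.mp hpd.posSemidef.nonneg
  rw [star_eq_conjTranspose] at hY
  have hval : ∀ P : Matrix (Fin n) (Fin n) ℂ, Pᴴ = P →
      (Yᴴ * Y * P).trace.re = (p P).re + ε * P.trace.re := by
    intro P hP
    rw [← hY, add_mul, trace_add, Complex.add_re, hρ P hP, smul_mul, one_mul, trace_smul,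
      smul_eq_mul, Complex.re_ofReal_mul]
  refine ⟨Yᴴ, ?_, ?_, fun m α => ?_⟩
  · have h := hpd.isUnit
    rw [hY, isUnit_iff_isUnit_det, det_mul] at h
    exact isUnit_of_mul_isUnit_left h
  · have h := hval 1 (by simp)
    simpa using h
  · have h := hval (αᴴ * α) (by simp)
    have e : (α * Yᴴ * (α * Yᴴ)ᴴ).trace = (Yᴴ * Y * (αᴴ * α)).trace := by
      rw [conjTranspose_mul, conjTranspose_conjTranspose, Matrix.mul_assoc, trace_mul_comm]
      simp only [Matrix.mul_assoc]
    rw [e, h, trace_mul_comm αᴴ α, re_trace_mul_conjTranspose]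
    have : 0 ≤ ε * ∑ i, ∑ j, ‖α i j‖ ^ 2 := by positivity
    linarith

end ScalarMatrices

end

/-! ### Convexity: domination of contractive functionals on `M_n(E)` -/

noncomputable section

section MatrixFunctionals

open scoped ENNReal Topology Matrix.Norms.L2Operator ComplexOrder MatrixOrder
open Filter OperatorSpace Matrix

theorem matBimul_matBimul {E : Type*} [AddCommGroup E] [Module ℂ E] {m n p : ℕ}
    (α : Matrix (Fin m) (Fin n) ℂ) (γ : Matrix (Fin n) (Fin p) ℂ) (x : Matrix (Fin p) (Fin p) E)
    (δ : Matrix (Fin p) (Fin n) ℂ) (β : Matrix (Fin n) (Fin m) ℂ) :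
    matBimul α (matBimul γ x δ) β = matBimul (α * γ) x (δ * β) := by
  ext i j
  simp only [matBimul, of_apply, mul_apply, Finset.smul_sum, Finset.sum_smul, smul_smul,
    Finset.sum_mul_sum]
  calc _ = ∑ k, ∑ a, ∑ l, ∑ b, (α i k * β l j * (γ k a * δ b l)) • x a b :=
        Finset.sum_congr rfl fun _ _ => Finset.sum_comm
    _ = ∑ a, ∑ k, ∑ b, ∑ l, (α i k * β l j * (γ k a * δ b l)) • x a b := by
        rw [Finset.sum_comm]
        exact Finset.sum_congr rfl fun _ _ => Finset.sum_congr rfl fun _ _ => Finset.sum_comm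
    _ = ∑ a, ∑ b, ∑ k, ∑ l, (α i k * β l j * (γ k a * δ b l)) • x a b :=
        Finset.sum_congr rfl fun _ _ => Finset.sum_comm
    _ = _ := by
        refine Finset.sum_congr rfl fun _ _ => Finset.sum_congr rfl fun _ _ =>
          Finset.sum_congr rfl fun _ _ => Finset.sum_congr rfl fun _ _ => ?_
        congr 1
        ring

theorem matBimul_one_one {E : Type*} [AddCommGroup E] [Module ℂ E] {n : ℕ}
    (x : Matrix (Fin n) (Fin n) E) : matBimul 1 x 1 = x := by
  ext i j
  simp [matBimul, one_apply]

/-- The matrix whose rows are those of `α` followed by those of `α'`. -/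
def appendRows {m m' n : ℕ} (α : Matrix (Fin m) (Fin n) ℂ) (α' : Matrix (Fin m') (Fin n) ℂ) :
    Matrix (Fin (m + m')) (Fin n) ℂ :=
  of fun i k => Fin.addCases (fun i => α i k) (fun i => α' i k) i

theorem matBimul_appendRows {E : Type*} [AddCommGroup E] [Module ℂ E] {m m' n : ℕ}
    (α β : Matrix (Fin m) (Fin n) ℂ) (α' β' : Matrix (Fin m') (Fin n) ℂ)
    (x : Matrix (Fin m) (Fin m) E) (y : Matrix (Fin m') (Fin m') E) :
    matBimul (appendRows α α')ᵀ (matDirectSum x y) (appendRows β β') =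
      matBimul αᵀ x β + matBimul α'ᵀ y β' := by
  ext i j
  simp [matBimul, appendRows, Fin.sum_univ_add, matDirectSum]

theorem appendRows_conjTranspose_mul_self {m m' n : ℕ} (α : Matrix (Fin m) (Fin n) ℂ)
    (α' : Matrix (Fin m') (Fin n) ℂ) :
    (appendRows α α')ᴴ * appendRows α α' = αᴴ * α + α'ᴴ * α' := by
  ext i j
  simp [appendRows, mul_apply, Fin.sum_univ_add]

variable {E : Type*} [NormedAddCommGroup E] [NormedSpace ℂ E]

/-- The linear functional `u ↦ ∑ φ_kl(u_kl)` on `M_n(E)` given by `φ ∈ M_n(E*)`. -/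
def matFunctional {n : ℕ} (φ : Matrix (Fin n) (Fin n) (StrongDual ℂ E)) :
    Matrix (Fin n) (Fin n) E →ₗ[ℂ] ℂ where
  toFun u := ∑ k, ∑ l, φ k l (u k l)
  map_add' u v := by simp [Finset.sum_add_distrib]
  map_smul' c u := by simp [Finset.mul_sum]

theorem matFunctional_apply {n : ℕ} (φ : Matrix (Fin n) (Fin n) (StrongDual ℂ E))
    (u : Matrix (Fin n) (Fin n) E) : matFunctional φ u = ∑ k, ∑ l, φ k l (u k l) := rfl

variable [OperatorSpace E]

/-- The convex cone of all `(αᴴ α, βᴴ β, Re φ(αᵀ x β))` with `x` in the unit ball of some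
`M_m(E)`. -/
def gramCone {n : ℕ} (φ : Matrix (Fin n) (Fin n) (StrongDual ℂ E)) :
    Set (Matrix (Fin n) (Fin n) ℂ × Matrix (Fin n) (Fin n) ℂ × ℂ) :=
  {z | ∃ (m : ℕ) (α β : Matrix (Fin m) (Fin n) ℂ) (x : Matrix (Fin m) (Fin m) E), mnorm x ≤ 1 ∧
    z = (αᴴ * α, βᴴ * β, ((matFunctional φ (matBimul αᵀ x β)).re : ℂ))}

/-- Both `α` and `β` are scaled by `√t`; all three coordinates are quadratic in the pair. -/
theorem smul_mem_gramCone {n : ℕ} {φ : Matrix (Fin n) (Fin n) (StrongDual ℂ E)} {z}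
    (hz : z ∈ gramCone φ) {t : ℝ} (ht : 0 ≤ t) : t • z ∈ gramCone φ := by
  obtain ⟨m, α, β, x, hx, rfl⟩ := hz
  have hs : (√t : ℂ) * √t = t := by exact_mod_cast Real.mul_self_sqrt ht
  have hb : matBimul ((√t : ℂ) • α)ᵀ x ((√t : ℂ) • β) = (t : ℂ) • matBimul αᵀ x β := by
    ext i j
    simp only [matBimul, of_apply, transpose_apply, Matrix.smul_apply, smul_eq_mul,
      Finset.smul_sum, smul_smul]
    refine Finset.sum_congr rfl fun k _ => Finset.sum_congr rfl fun l _ => ?_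
    rw [← hs]
    congr 1
    ring
  refine ⟨m, (√t : ℂ) • α, (√t : ℂ) • β, x, hx, ?_⟩
  rw [hb]
  simp only [conjTranspose_smul, Matrix.smul_mul, Matrix.mul_smul, smul_smul, map_smul,
    smul_eq_mul, Complex.re_ofReal_mul, RCLike.star_def, Complex.conj_ofReal, hs]
  ext <;> simp

/-- Ruan's axiom for direct sums enters here: stacking the rows of the scalar matrices adds the Gram
matrices, while `x ⊕ x'` stays in the unit ball. This is what makes a single separation argument
possible. -/
theorem add_mem_gramCone {n : ℕ} {φ : Matrix (Fin n) (Fin n) (StrongDual ℂ E)} {z w}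
    (hz : z ∈ gramCone φ) (hw : w ∈ gramCone φ) : z + w ∈ gramCone φ := by
  obtain ⟨m, α, β, x, hx, rfl⟩ := hz
  obtain ⟨m', α', β', x', hx', rfl⟩ := hw
  refine ⟨m + m', appendRows α α', appendRows β β', matDirectSum x x',
    (mnorm_directSum_le _ _).trans (max_le hx hx'), ?_⟩
  rw [appendRows_conjTranspose_mul_self, appendRows_conjTranspose_mul_self, matBimul_appendRows]
  simp

/-- Contractivity of `φ` gives the bound `‖α‖ ‖β‖`. Conclude by `2ab ≤ a² + b²` and the C*-identity.
-/
theorem re_le_of_mem_gramCone {n : ℕ} {φ : Matrix (Fin n) (Fin n) (StrongDual ℂ E)}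
    (hφ : ∀ u, ‖matFunctional φ u‖ ≤ mnorm u) {z} (hz : z ∈ gramCone φ) :
    2 * z.2.2.re ≤ ‖z.1‖ + ‖z.2.1‖ := by
  obtain ⟨m, α, β, x, hx, rfl⟩ := hz
  simp only [Complex.ofReal_re, l2_opNorm_conjTranspose_mul_self]
  have h1 := (Complex.re_le_norm _).trans (hφ (matBimul αᵀ x β))
  have h2 := mnorm_bimul_le αᵀ x β
  have h3 : ‖αᵀ‖ * mnorm x * ‖β‖ ≤ ‖α‖ * 1 * ‖β‖ := by
    have := mnorm_nonneg x
    gcongr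
    exact l2_opNorm_transpose_le α
  nlinarith [sq_nonneg (‖α‖ - ‖β‖)]

/-- The convexity theorem of Effros and Ruan: a contractive functional on `M_n(E)` is dominated by
two positive functionals of norm one on `M_n`. -/
theorem exists_dominating_functionals {n : ℕ} (φ : Matrix (Fin n) (Fin n) (StrongDual ℂ E))
    (hφ : ∀ u, ‖matFunctional φ u‖ ≤ mnorm u) :
    ∃ p q : Matrix (Fin n) (Fin n) ℂ →ₗ[ℂ] ℂ, (p 1).re ≤ 1 ∧ (q 1).re ≤ 1 ∧
      ∀ (m : ℕ) (α β : Matrix (Fin m) (Fin n) ℂ) (x : Matrix (Fin m) (Fin m) E), mnorm x ≤ 1 →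
        2 * (matFunctional φ (matBimul αᵀ x β)).re ≤ (p (αᴴ * α)).re + (q (βᴴ * β)).re := by
  -- The region forbidden by `re_le_of_mem_gramCone`; a functional separating it from the cone
  -- provides `p` and `q`.
  let O : Set (Matrix (Fin n) (Fin n) ℂ × Matrix (Fin n) (Fin n) ℂ × ℂ) := {z | ‖z.1‖ + ‖z.2.1‖ < 2 * z.2.2.re}
  have hOo : IsOpen O := isOpen_lt (by fun_prop) (by fun_prop)
  have hOc : Convex ℝ O := by
    intro z hz w hw a b ha hb hab
    simp only [O, Set.mem_ofPred_eq] at hz hw ⊢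
    have h1 := norm_add_le (a • z.1) (b • w.1)
    have h2 := norm_add_le (a • z.2.1) (b • w.2.1)
    rw [norm_smul, norm_smul, Real.norm_of_nonneg ha, Real.norm_of_nonneg hb] at h1 h2
    have e : (a • z + b • w).2.2.re = a * z.2.2.re + b * w.2.2.re := by simp
    rw [e]
    change ‖a • z.1 + b • w.1‖ + ‖a • z.2.1 + b • w.2.1‖ < _
    rcases ha.eq_or_lt with rfl | ha
    · have : b = 1 := by linarith
      subst this; linarith
    · nlinarith
  have hCc : Convex ℝ (gramCone φ) := fun z hz w hw a b ha hb _ =>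
    add_mem_gramCone (smul_mem_gramCone hz ha) (smul_mem_gramCone hw hb)
  have hd : Disjoint O (gramCone φ) := by
    rw [Set.disjoint_left]
    intro z hz hz'
    exact absurd (re_le_of_mem_gramCone hφ hz') (not_le.2 hz)
  obtain ⟨f, u, hfO, hfC⟩ := RCLike.geometric_hahn_banach_open (𝕜 := ℂ) hOc hOo hCc hd
  have hreal : ∀ (t : ℝ) (z : Matrix (Fin n) (Fin n) ℂ × Matrix (Fin n) (Fin n) ℂ × ℂ), (f (t • z)).re = t * (f z).re := by
    intro t z
    have : t • z = (t : ℂ) • z := (Complex.coe_smul t z).symm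
    rw [this, map_smul, smul_eq_mul, Complex.re_ofReal_mul]
  have h0mem : (0 : Matrix (Fin n) (Fin n) ℂ × Matrix (Fin n) (Fin n) ℂ × ℂ) ∈ gramCone φ :=
    ⟨0, 0, 0, 0, by rw [mnorm_zero]; norm_num, by
      ext <;> simp [matBimul, matFunctional_apply]⟩
  have hu0 : u ≤ 0 := by simpa using hfC 0 h0mem
  -- On a cone, a functional bounded below is nonnegative: otherwise a multiple of `z` would take
  -- the value `u - 1`.
  have hC0 : ∀ z ∈ gramCone φ, 0 ≤ (f z).re := by
    intro z hz
    by_contra! hlt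
    have h := hfC _ (smul_mem_gramCone hz (t := (u - 1) / (f z).re)
      (div_nonneg_of_nonpos (by linarith) hlt.le))
    rw [RCLike.re_eq_complex_re, hreal, div_mul_cancel₀ _ hlt.ne] at h
    linarith
  have hO0 : ∀ z ∈ O, (f z).re < 0 := fun z hz => (hfO z hz).trans_le hu0
  set τ : ℝ := -(f (0, 0, 1)).re with hτ
  have hτ0 : 0 < τ := by
    have := hO0 (0, 0, 1) (by simp [O])
    linarith
  have hthird : ∀ t : ℝ, (f (0, 0, (t : ℂ))).re = -(t * τ) := by
    intro t
    have := hreal t (0, 0, 1)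
    simp only [Prod.smul_mk, smul_zero, Complex.real_smul, mul_one] at this
    rw [this, hτ]; ring
  have hsum : ∀ P Q (t : ℝ), (f (P, Q, (t : ℂ))).re =
      (f (P, 0, 0)).re + (f (0, Q, 0)).re - t * τ := by
    intro P Q t
    have : ((P, Q, (t : ℂ)) : Matrix (Fin n) (Fin n) ℂ × Matrix (Fin n) (Fin n) ℂ × ℂ) = (P, 0, 0) + (0, Q, 0) + (0, 0, (t : ℂ)) := by simp
    rw [this, map_add, map_add, Complex.add_re, Complex.add_re, hthird]
    ring
  have hone : ‖(1 : Matrix (Fin n) (Fin n) ℂ)‖ ≤ 1 := by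
    refine scalar_norm_le _ zero_le_one fun v => by simp
  have hbound : ∀ a : ℝ, (∀ ε : ℝ, 0 < ε → a < (1 / 2 + ε) * τ) → 2 / τ * a ≤ 1 := by
    intro a ha
    rw [div_mul_eq_mul_div, div_le_one hτ0]
    have : a ≤ τ * (1 / 2) := le_of_forall_pos_lt_add fun ε hε => by
      have h := ha (ε / τ) (by positivity)
      rwa [add_mul, div_mul_cancel₀ _ hτ0.ne', mul_comm] at h
    linarith
  have hf0 : (f (0, 0, 0)).re = 0 := by
    have : ((0, 0, 0) : Matrix (Fin n) (Fin n) ℂ × Matrix (Fin n) (Fin n) ℂ × ℂ) = 0 := rfl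
    rw [this]; simp
  -- Normalized by `τ`, the nonnegativity of `f` on the cone is exactly the desired domination.
  refine ⟨((2 / τ : ℝ) : ℂ) • (f.toLinearMap ∘ₗ LinearMap.inl ℂ _ _),
    ((2 / τ : ℝ) : ℂ) • (f.toLinearMap ∘ₗ LinearMap.inr ℂ _ _ ∘ₗ LinearMap.inl ℂ _ _),
    ?_, ?_, fun m α β x hx => ?_⟩
  · simp only [LinearMap.smul_apply, smul_eq_mul, Complex.re_ofReal_mul, LinearMap.comp_apply]
    refine hbound (f (1, 0, 0)).re fun ε hε => ?_
    -- Since `‖1‖ ≤ 1 < 2 (1/2 + ε)`, this point lies in `O`; hence the normalization `(p 1).re ≤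
    -- 1`.
    have h := hO0 (1, 0, ((1 / 2 + ε : ℝ) : ℂ)) (by
      simp only [O, Set.mem_ofPred_eq, norm_zero, Complex.ofReal_re]
      linarith)
    rw [hsum, hf0] at h
    linarith
  · simp only [LinearMap.smul_apply, smul_eq_mul, Complex.re_ofReal_mul, LinearMap.comp_apply]
    refine hbound (f (0, 1, 0)).re fun ε hε => ?_
    have h := hO0 (0, 1, ((1 / 2 + ε : ℝ) : ℂ)) (by
      simp only [O, Set.mem_ofPred_eq, norm_zero, Complex.ofReal_re]
      linarith)
    rw [hsum, hf0] at h
    linarith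
  · have h := hC0 _ ⟨m, α, β, x, hx, rfl⟩
    rw [hsum] at h
    simp only [LinearMap.smul_apply, smul_eq_mul, Complex.re_ofReal_mul, LinearMap.comp_apply]
    change _ ≤ 2 / τ * (f (αᴴ * α, 0, 0)).re + 2 / τ * (f (0, βᴴ * β, 0)).re
    rw [← mul_add, div_mul_eq_mul_div, le_div_iff₀ hτ0]
    linarith

end MatrixFunctionals

end

/-! ### Contractive functionals on `M_n(E)` extended to `M_n(E**)` -/

noncomputable section

section BidualBound

open scoped ENNReal Topology Matrix.Norms.L2Operator ComplexOrder MatrixOrder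
open Filter OperatorSpace Matrix

/-- Taking `w` to be the conjugate of `A v` gives `2‖Av‖² ≤ ‖Av‖² + ‖v‖²`. The additive form matches
the bounds by `p` and `q`. -/
theorem scalar_norm_le_one_of_re {ι κ : Type*} [Fintype ι] [Fintype κ] [DecidableEq κ]
    (A : Matrix ι κ ℂ)
    (h : ∀ (w : ι → ℂ) (v : κ → ℂ), 2 * (w ⬝ᵥ A.mulVec v).re ≤ ∑ i, ‖w i‖ ^ 2 + ∑ j, ‖v j‖ ^ 2) :
    ‖A‖ ≤ 1 := by
  refine scalar_norm_le A zero_le_one fun v => ?_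
  have h1 := h (star (A.mulVec v)) v
  have e : (star (A.mulVec v) ⬝ᵥ A.mulVec v).re = ∑ i, ‖A.mulVec v i‖ ^ 2 := by
    simp only [dotProduct, Complex.re_sum]
    refine Finset.sum_congr rfl fun i _ => ?_
    rw [mul_comm, Pi.star_apply, RCLike.star_def, Complex.mul_conj, Complex.ofReal_re,
      Complex.normSq_eq_norm_sq]
  rw [e] at h1
  simp only [Pi.star_apply, norm_star] at h1
  rw [one_mul, ← sq_le_sq₀ (norm_nonneg _) (norm_nonneg _), EuclideanSpace.norm_sq_eq,
    EuclideanSpace.norm_sq_eq]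
  simp only
  linarith

variable {E : Type*} [NormedAddCommGroup E] [NormedSpace ℂ E]

/-- Vectors indexed by `Fin n × Fin m` are read as `m × n` matrices. Operator norm estimates for the
pairing thus become estimates for `φ` on products `αᵀ x β`, with Euclidean norms turned into
Hilbert–Schmidt norms. -/
theorem dotProduct_dualPairing_mulVec {n m : ℕ} (φ : Matrix (Fin n) (Fin n) (StrongDual ℂ E))
    (x : Matrix (Fin m) (Fin m) E) (w v : Fin n × Fin m → ℂ) :
    w ⬝ᵥ (dualPairing φ x).mulVec v = matFunctional φ
      (matBimul (of fun i p => w (p, i) : Matrix (Fin m) (Fin n) ℂ)ᵀ x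
        (of fun i p => v (p, i))) := by
  simp only [dotProduct, mulVec, dualPairing, of_apply, Fintype.sum_prod_type, matFunctional_apply,
    matBimul, transpose_apply, map_sum, map_smul, smul_eq_mul, Finset.mul_sum]
  refine Finset.sum_congr rfl fun i _ => ?_
  rw [Finset.sum_comm]
  refine Finset.sum_congr rfl fun j _ => Finset.sum_congr rfl fun k _ =>
    Finset.sum_congr rfl fun l _ => ?_
  ring

theorem matFunctional_matBimul {n m : ℕ} (φ : Matrix (Fin n) (Fin n) (StrongDual ℂ E))
    (γ δ : Matrix (Fin m) (Fin n) ℂ) (u : Matrix (Fin m) (Fin m) E) :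
    matFunctional (matBimul γ φ δᵀ) u = matFunctional φ (matBimul γᵀ u δ) := by
  simp only [matFunctional_apply, matBimul, of_apply, transpose_apply, map_sum, map_smul,
    _root_.sum_apply, _root_.smul_apply, smul_eq_mul]
  calc _ = ∑ p, ∑ k, ∑ q, ∑ l, γ p k * δ q l * φ k l (u p q) :=
        Finset.sum_congr rfl fun _ _ => Finset.sum_comm
    _ = ∑ k, ∑ p, ∑ l, ∑ q, γ p k * δ q l * φ k l (u p q) := by
        rw [Finset.sum_comm]
        exact Finset.sum_congr rfl fun _ _ => Finset.sum_congr rfl fun _ _ => Finset.sum_comm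
    _ = _ := Finset.sum_congr rfl fun _ _ => Finset.sum_comm

variable [OperatorSpace E]

/-- A contractive functional on `M_n(E)` remains contractive on `M_n(E**)`. -/
theorem norm_matFunctional_bidual_le {n : ℕ} (φ : Matrix (Fin n) (Fin n) (StrongDual ℂ E))
    (hφ : ∀ u, ‖matFunctional φ u‖ ≤ mnorm u)
    (X : Matrix (Fin n) (Fin n) (StrongDual ℂ (StrongDual ℂ E))) :
    ‖matFunctional X φ‖ ≤ dualMnorm X := by
  obtain ⟨p, q, hp1, hq1, hpq⟩ := exists_dominating_functionals φ hφ
  -- Positivity of `p` is the domination inequality with `β = 0` and `x = 0`.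
  have hp0 : ∀ α : Matrix (Fin 1) (Fin n) ℂ, 0 ≤ (p (αᴴ * α)).re := fun α => by
    simpa [matBimul, matFunctional_apply] using hpq 1 α 0 0 (by rw [mnorm_zero]; norm_num)
  have hq0 : ∀ α : Matrix (Fin 1) (Fin n) ℂ, 0 ≤ (q (αᴴ * α)).re := fun α => by
    simpa [matBimul, matFunctional_apply] using hpq 1 0 α 0 (by rw [mnorm_zero]; norm_num)
  suffices key : ∀ ε : ℝ, 0 < ε → ‖matFunctional X φ‖ ≤ dualMnorm X * (1 + ε * n) by
    have hlim : Tendsto (fun ε : ℝ => dualMnorm X * (1 + ε * n)) (𝓝[>] 0)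
        (𝓝 (dualMnorm X * (1 + 0 * n))) :=
      Tendsto.mono_left (Continuous.tendsto (by fun_prop) 0) nhdsWithin_le_nhds
    rw [zero_mul, add_zero, mul_one] at hlim
    exact ge_of_tendsto hlim (eventually_nhdsWithin_of_forall fun ε hε => key ε hε)
  intro ε hε
  obtain ⟨B, hBu, hB1, hB⟩ := exists_invertible_factor p hp0 hε
  obtain ⟨D, hDu, hD1, hD⟩ := exists_invertible_factor q hq0 hε
  set ψ : Matrix (Fin n) (Fin n) (StrongDual ℂ E) := matBimul B⁻¹ φ (D⁻¹)ᵀ with hψ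
  have hφψ : φ = matBimul B ψ Dᵀ := by
    rw [hψ, matBimul_matBimul, ← transpose_mul, mul_nonsing_inv _ hBu, mul_nonsing_inv _ hDu,
      transpose_one, matBimul_one_one]
  -- The pairing of `ψ` with `x` is `φ` evaluated at `(W B⁻¹)ᵀ x (V D⁻¹)`. The factors `B⁻¹`, `D⁻¹`
  -- cancel against the trace bounds for `p` and `q`, leaving the squared Hilbert–Schmidt norms of
  -- `W` and `V`.
  have hψ1 : mnorm ψ ≤ 1 := by
    refine ciSup_le fun x => scalar_norm_le_one_of_re _ fun w v => ?_
    rw [dotProduct_dualPairing_mulVec, hψ, matFunctional_matBimul, matBimul_matBimul,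
      ← transpose_mul]
    set W : Matrix (Fin x.1) (Fin n) ℂ := of fun i p => w (p, i) with hW
    set V : Matrix (Fin x.1) (Fin n) ℂ := of fun i p => v (p, i) with hV
    have h := hpq _ (W * B⁻¹) (V * D⁻¹) x.2.1 x.2.2
    have h1 := hB _ (W * B⁻¹)
    have h2 := hD _ (V * D⁻¹)
    rw [nonsing_inv_mul_cancel_right _ _ hBu, re_trace_mul_conjTranspose, Finset.sum_comm] at h1
    rw [nonsing_inv_mul_cancel_right _ _ hDu, re_trace_mul_conjTranspose, Finset.sum_comm] at h2
    simp only [Fintype.sum_prod_type]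
    exact h.trans (add_le_add h1 h2)
  let w : Fin n × Fin n → ℂ := fun r => B r.1 r.2
  let v : Fin n × Fin n → ℂ := fun r => D r.1 r.2
  -- The entries of `B` and `D` serve as vectors; their squared norms are the traces controlled by
  -- `hB1` and `hD1`.
  have hval : matFunctional X φ = w ⬝ᵥ (dualPairing X ψ).mulVec v := by
    rw [dotProduct_dualPairing_mulVec]
    conv_lhs => rw [hφψ]
    rfl
  have hw : ‖WithLp.toLp 2 w‖ ^ 2 ≤ 1 + ε * n := by
    rw [EuclideanSpace.norm_sq_eq, Fintype.sum_prod_type]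
    rw [re_trace_mul_conjTranspose] at hB1
    exact hB1.le.trans (by linarith)
  have hv : ‖WithLp.toLp 2 v‖ ^ 2 ≤ 1 + ε * n := by
    rw [EuclideanSpace.norm_sq_eq, Fintype.sum_prod_type]
    rw [re_trace_mul_conjTranspose] at hD1
    exact hD1.le.trans (by linarith)
  have hX : ‖dualPairing X ψ‖ ≤ dualMnorm X := norm_dualPairing_le_dualMnorm X ⟨n, ψ, hψ1⟩
  rw [hval]
  refine (scalar_bilin_le _ _ _).trans (mul_le_mul hX ?_ (by positivity) (dualMnorm_nonneg X))
  nlinarith [sq_nonneg (‖WithLp.toLp 2 w‖ - ‖WithLp.toLp 2 v‖)]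

end BidualBound

end

/-! ### Approximating a matrix over the bidual by matrices over `E` -/

noncomputable section

section LocalLift

open scoped ENNReal Topology
open Filter OperatorSpace Matrix

section Continuity

variable {E : Type*} [NormedAddCommGroup E] [NormedSpace ℂ E] [OperatorSpace E]

theorem continuous_mnorm {n : ℕ} : Continuous fun u : Fin n → Fin n → E => mnorm (of u) := by
  rw [continuous_iff_continuousAt]
  intro u
  rw [ContinuousAt, tendsto_iff_norm_sub_tendsto_zero]
  have h : Tendsto (fun v : Fin n → Fin n → E => ∑ k, ∑ l, ‖v k l - u k l‖) (𝓝 u) (𝓝 0) := by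
    have : Continuous fun v : Fin n → Fin n → E => ∑ k, ∑ l, ‖v k l - u k l‖ := by fun_prop
    simpa using this.tendsto u
  refine squeeze_zero (fun _ => norm_nonneg _) (fun v => ?_) h
  rw [Real.norm_eq_abs]
  exact (abs_mnorm_sub_le _ _).trans (mnorm_le_sum_norm _)

theorem mnorm_convex_lt {n : ℕ} {x y : Matrix (Fin n) (Fin n) E} {r : ℝ} (hx : mnorm x < r)
    (hy : mnorm y < r) {a b : ℝ} (ha : 0 ≤ a) (hb : 0 ≤ b) (hab : a + b = 1) :
    mnorm ((a : ℂ) • x + (b : ℂ) • y) < r := by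
  have h := mnorm_add_le ((a : ℂ) • x) ((b : ℂ) • y)
  rw [mnorm_smul, mnorm_smul, Complex.norm_real, Complex.norm_real, Real.norm_of_nonneg ha,
    Real.norm_of_nonneg hb] at h
  rcases ha.eq_or_lt with rfl | ha
  · have : b = 1 := by linarith
    subst this; linarith
  · have h1 := mul_lt_mul_of_pos_left hx ha
    have h2 := mul_le_mul_of_nonneg_left hy.le hb
    have h3 : a * r + b * r = r := by rw [← add_mul, hab, one_mul]
    linarith

theorem mnorm_inv_smul_lt_one {n : ℕ} {x : Matrix (Fin n) (Fin n) E} {r : ℝ} (hr : mnorm x < r) :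
    mnorm (((r⁻¹ : ℝ) : ℂ) • x) < 1 := by
  have hr0 : 0 < r := (mnorm_nonneg x).trans_lt hr
  rw [mnorm_smul, Complex.norm_real, Real.norm_of_nonneg (by positivity), inv_mul_lt_one₀ hr0]
  exact hr

theorem le_const_mul_of_forall_lt {a b C : ℝ} (h : ∀ r, b < r → a ≤ C * r) : a ≤ C * b := by
  have hlim : Tendsto (fun r => C * r) (𝓝[>] b) (𝓝 (C * b)) :=
    Tendsto.mono_left (Continuous.tendsto (by fun_prop) _) nhdsWithin_le_nhds
  exact ge_of_tendsto hlim (eventually_nhdsWithin_of_forall fun r hr => h r hr)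

end Continuity

variable {E : Type*} [NormedAddCommGroup E] [NormedSpace ℂ E]

/-- The hypothesis says that `∑ x_s ⊗ y_s` vanishes in the algebraic tensor product `E** ⊗ E*`, so
its image under evaluation vanishes too. Expanding the `x_s` in a Hamel basis makes this explicit;
the coordinates are purely algebraic functionals. -/
theorem sum_apply_eq_zero_of_forall_dual {σ : Type*} [Fintype σ]
    (x : σ → StrongDual ℂ (StrongDual ℂ E)) (y : σ → StrongDual ℂ E)
    (h : ∀ (f : Module.Dual ℂ (StrongDual ℂ (StrongDual ℂ E))) (w : E),
      ∑ s, f (x s) * y s w = 0) :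
    ∑ s, x s (y s) = 0 := by
  classical
  let b := Module.Basis.ofVectorSpace ℂ (StrongDual ℂ (StrongDual ℂ E))
  let T := Finset.univ.biUnion fun s => (b.repr (x s)).support
  have hx : ∀ s, x s = ∑ i ∈ T, b.repr (x s) i • b i := by
    intro s
    conv_lhs => rw [← b.linearCombination_repr (x s)]
    rw [Finsupp.linearCombination_apply]
    refine Finsupp.sum_of_support_subset _ ?_ _ (by simp)
    exact Finset.subset_biUnion_of_mem (fun s => (b.repr (x s)).support) (Finset.mem_univ s)
  have hy : ∀ i, ∑ s, b.repr (x s) i • y s = 0 := by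
    intro i
    ext w
    simpa using h (b.coord i) w
  calc ∑ s, x s (y s) = ∑ s, ∑ i ∈ T, b i (b.repr (x s) i • y s) := by
        refine Finset.sum_congr rfl fun s _ => ?_
        conv_lhs => rw [hx s]
        simp
    _ = ∑ i ∈ T, b i (∑ s, b.repr (x s) i • y s) := by
        rw [Finset.sum_comm]
        exact Finset.sum_congr rfl fun i _ => (map_sum _ _ _).symm
    _ = 0 := by simp [hy]

variable [OperatorSpace E]

/-- A weak form of local reflexivity, valid in all operator spaces: a matrix in the open unit ball
of `M_n(E**)` is approximated by matrices in the open unit ball of `M_n(E)`, linearly in its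
entries. -/
theorem exists_linearMap_mnorm_lt_one {n : ℕ}
    (X : Matrix (Fin n) (Fin n) (StrongDual ℂ (StrongDual ℂ E))) (hX : dualMnorm X < 1)
    {τ : Type*} [Fintype τ] (f : τ → StrongDual ℂ (StrongDual ℂ E)) (g : τ → StrongDual ℂ E)
    {δ : ℝ} (hδ : 0 < δ) :
    ∃ A : StrongDual ℂ (StrongDual ℂ E) →ₗ[ℂ] E, mnorm (X.map A) < 1 ∧
      ∀ t, ‖g t (A (f t)) - f t (g t)‖ < δ := by
  classical
  -- `D` is the range of `A ↦ (A X, (g_t (A f_t)))` enlarged by the open unit ball of `M_n(E)` and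
  -- an open polydisc of radius `δ`. The claim is that it contains `(0, (f_t (g_t)))`.
  let D : Set ((Fin n → Fin n → E) × (τ → ℂ)) := ⋃ A : StrongDual ℂ (StrongDual ℂ E) →ₗ[ℂ] E,
    {z | mnorm (of fun k l => A (X k l) - z.1 k l) < 1 ∧ ∀ t, ‖g t (A (f t)) - z.2 t‖ < δ}
  have hDmem : ∀ z, z ∈ D ↔ ∃ A : StrongDual ℂ (StrongDual ℂ E) →ₗ[ℂ] E,
      mnorm (of fun k l => A (X k l) - z.1 k l) < 1 ∧ ∀ t, ‖g t (A (f t)) - z.2 t‖ < δ := by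
    intro z; simp [D]
  by_contra hcon
  have hz0 : ((0 : Fin n → Fin n → E), fun t => f t (g t)) ∉ D := by
    rw [hDmem]
    rintro ⟨A, h1, h2⟩
    refine hcon ⟨A, ?_, h2⟩
    simpa [Matrix.map] using h1
  have hDo : IsOpen D := by
    refine isOpen_iUnion fun A => ?_
    refine IsOpen.inter (s := {z : (Fin n → Fin n → E) × (τ → ℂ) | mnorm (of fun k l => A (X k l) - z.1 k l) < 1}) ?_ ?_
    · refine isOpen_lt (continuous_mnorm.comp (f := fun z : (Fin n → Fin n → E) × (τ → ℂ) =>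
        fun k l => A (X k l) - z.1 k l) ?_) continuous_const
      fun_prop
    · have : {z : (Fin n → Fin n → E) × (τ → ℂ) | ∀ t, ‖g t (A (f t)) - z.2 t‖ < δ} =
          ⋂ t, {z | ‖g t (A (f t)) - z.2 t‖ < δ} := by ext; simp
      change IsOpen {z : (Fin n → Fin n → E) × (τ → ℂ) | ∀ t, ‖g t (A (f t)) - z.2 t‖ < δ}
      rw [this]
      exact isOpen_iInter_of_finite fun t => isOpen_lt (by fun_prop) continuous_const
  have hDc : Convex ℝ D := by
    intro z hz w hw a b ha hb hab
    rw [hDmem] at hz hw ⊢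
    obtain ⟨A, hA1, hA2⟩ := hz
    obtain ⟨B, hB1, hB2⟩ := hw
    refine ⟨(a : ℂ) • A + (b : ℂ) • B, ?_, fun t => ?_⟩
    · refine lt_of_eq_of_lt (congrArg mnorm ?_) (mnorm_convex_lt hA1 hB1 ha hb hab)
      ext k l
      simp [smul_sub]
      abel
    · have e : g t (((a : ℂ) • A + (b : ℂ) • B) (f t)) - (a • z + b • w).2 t =
          a • (g t (A (f t)) - z.2 t) + b • (g t (B (f t)) - w.2 t) := by
        simp
        ring
      have h := convex_ball (0 : ℂ) δ (mem_ball_zero_iff.2 (hA2 t)) (mem_ball_zero_iff.2 (hB2 t))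
        ha hb hab
      rw [e]
      exact mem_ball_zero_iff.1 h
  obtain ⟨F, hF⟩ := RCLike.geometric_hahn_banach_open_point (𝕜 := ℂ) hDc hDo hz0
  simp only [RCLike.re_eq_complex_re] at hF
  set c : ℝ := (F (0, fun t => f t (g t))).re with hc
  have hc0 : 0 < c := by
    have := hF 0 ((hDmem _).2 ⟨0, by
      have : (of fun k l => (0 : StrongDual ℂ (StrongDual ℂ E) →ₗ[ℂ] E) (X k l) -
          (0 : (Fin n → Fin n → E) × (τ → ℂ)).1 k l) = 0 := by ext; simp
      rw [this, mnorm_zero]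
      exact zero_lt_one, by simpa using fun _ => hδ⟩)
    simpa using this
  have hFu : ∀ u : Matrix (Fin n) (Fin n) E, mnorm u < 1 → (F ((fun k l => u k l), 0)).re < c := by
    intro u hu
    refine hF _ ((hDmem _).2 ⟨0, ?_, by simpa using fun _ => hδ⟩)
    have : (of fun k l => (0 : StrongDual ℂ (StrongDual ℂ E) →ₗ[ℂ] E) (X k l) - u k l) = -u := by
      ext; simp
    simpa only [this, mnorm_neg] using hu
  let L : (StrongDual ℂ (StrongDual ℂ E) →ₗ[ℂ] E) →ₗ[ℂ] ℂ :=
    { toFun := fun A => F (fun k l => A (X k l), fun t => g t (A (f t)))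
      map_add' := fun A B => by
        rw [← map_add]
        congr 1
        ext <;> simp
      map_smul' := fun r A => by
        rw [RingHom.id_apply, ← map_smul]
        congr 1
        ext <;> simp }
  -- The range is a linear subspace inside `D`, so `F` vanishes on it: a nonzero value could be
  -- rescaled to `c`.
  have hL : ∀ A, L A = 0 := by
    intro A
    by_contra hne
    have h := hF (fun k l => ((c / L A : ℂ) • A) (X k l), fun t => g t (((c / L A : ℂ) • A) (f t)))
      ((hDmem _).2 ⟨(c / L A : ℂ) • A, by
        have : (of fun k l => ((c / L A : ℂ) • A) (X k l) - ((c / L A : ℂ) • A) (X k l)) =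
            (0 : Matrix (Fin n) (Fin n) E) := by ext; simp
        rw [this, mnorm_zero]
        exact zero_lt_one, by simpa using fun _ => hδ⟩)
    change (L ((c / L A : ℂ) • A)).re < c at h
    rw [map_smul, smul_eq_mul, div_mul_cancel₀ _ hne, Complex.ofReal_re] at h
    exact lt_irrefl _ h
  let φ : Matrix (Fin n) (Fin n) (StrongDual ℂ E) := of fun k l =>
    F.comp ((ContinuousLinearMap.inl ℂ _ _).comp
      ((ContinuousLinearMap.single ℂ (fun _ : Fin n => Fin n → E) k).comp
        (ContinuousLinearMap.single ℂ (fun _ : Fin n => E) l)))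
  let lam : τ → ℂ := fun t => F (0, Pi.single t 1)
  have hFφ : ∀ u : Matrix (Fin n) (Fin n) E, F ((fun k l => u k l), 0) = matFunctional φ u := by
    intro u
    have e : ((fun k l => u k l, 0) : (Fin n → Fin n → E) × (τ → ℂ)) =
        ∑ k, ∑ l, (Pi.single k (Pi.single l (u k l)), 0) := by
      ext a b
      · simp [Prod.fst_sum, Finset.sum_apply, Pi.single_apply, ite_apply]
      · simp [Prod.snd_sum]
    rw [e]
    simp only [map_sum]
    rfl
  have hFlam : ∀ v : τ → ℂ, F (0, v) = ∑ t, lam t * v t := by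
    intro v
    have e : ((0, v) : (Fin n → Fin n → E) × (τ → ℂ)) = ∑ t, v t • (0, Pi.single t (1 : ℂ)) := by
      ext a b
      · simp [Prod.fst_sum]
      · simp [Prod.snd_sum, Finset.sum_apply, Pi.single_apply]
    rw [e, map_sum]
    exact Finset.sum_congr rfl fun t _ => by rw [map_smul, smul_eq_mul, mul_comm]
  -- Multiplying `u` by a phase makes the value real and nonnegative, so the bound on real parts
  -- bounds the modulus.
  have hφ1 : ∀ u : Matrix (Fin n) (Fin n) E, mnorm u < 1 → ‖matFunctional φ u‖ ≤ c := by
    intro u hu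
    rcases eq_or_ne (matFunctional φ u) 0 with h0 | h0
    · rw [h0, norm_zero]; exact hc0.le
    · set y := matFunctional φ u with hy
      have hn : (‖y‖ : ℂ) ≠ 0 := by simpa using h0
      have h := hFu (((‖y‖ : ℂ) / y) • u) (by
        rw [mnorm_smul, norm_div, Complex.norm_real, norm_norm,
          div_self (norm_ne_zero_iff.2 h0), one_mul]
        exact hu)
      rw [hFφ, map_smul, smul_eq_mul, ← hy, div_mul_cancel₀ _ h0, Complex.ofReal_re] at h
      exact h.le
  have hφ2 : ∀ u : Matrix (Fin n) (Fin n) E, ‖matFunctional φ u‖ ≤ c * mnorm u := by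
    intro u
    refine le_const_mul_of_forall_lt fun r hr => ?_
    have hr0 : 0 < r := (mnorm_nonneg u).trans_lt hr
    have h := hφ1 _ (mnorm_inv_smul_lt_one hr)
    rw [map_smul, norm_smul, Complex.norm_real, Real.norm_of_nonneg (by positivity),
      inv_mul_le_iff₀ hr0] at h
    linarith
  have hbid : ‖matFunctional X φ‖ ≤ c * dualMnorm X := by
    have hcn : ‖((c⁻¹ : ℝ) : ℂ)‖ = c⁻¹ := by
      rw [Complex.norm_real, Real.norm_of_nonneg (by positivity)]
    have h := norm_matFunctional_bidual_le (((c⁻¹ : ℝ) : ℂ) • φ) (fun u => by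
      have : matFunctional (((c⁻¹ : ℝ) : ℂ) • φ) u = ((c⁻¹ : ℝ) : ℂ) * matFunctional φ u := by
        simp [matFunctional_apply, Finset.mul_sum]
      rw [this, norm_mul, hcn, inv_mul_le_iff₀ hc0]
      exact hφ2 u) X
    rw [map_smul, norm_smul, hcn, inv_mul_le_iff₀ hc0] at h
    exact h
  -- Apply `hL` to the rank-one maps `h(·) w`. Their vanishing says that the tensor attached to `F`
  -- is zero, and evaluating it gives the identity.
  have hsum : matFunctional X φ + ∑ t, lam t * f t (g t) = 0 := by
    have h := sum_apply_eq_zero_of_forall_dual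
      (Sum.elim (fun p : Fin n × Fin n => X p.1 p.2) f)
      (Sum.elim (fun p : Fin n × Fin n => φ p.1 p.2) (fun t => lam t • g t)) (fun h w => by
        have h1 := hL (LinearMap.smulRight h w)
        have e : L (LinearMap.smulRight h w) = F (fun k l => h (X k l) • w, 0) +
            F (0, fun t => g t (h (f t) • w)) := by
          rw [← map_add]
          simp [L]
        rw [e, hFlam] at h1
        have e2 := hFφ (of fun k l => h (X k l) • w)
        simp only [of_apply] at e2
        rw [e2, matFunctional_apply] at h1
        rw [Fintype.sum_sum_type, Fintype.sum_prod_type, ← h1]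
        simp only [Sum.elim_inl, Sum.elim_inr, of_apply, map_smul, smul_eq_mul,
          _root_.smul_apply]
        congr 1
        exact Finset.sum_congr rfl fun t _ => by ring)
    rw [Fintype.sum_sum_type, Fintype.sum_prod_type] at h
    simpa [matFunctional_apply] using h
  have hcval : c = -(matFunctional X φ).re := by
    rw [hc, hFlam, ← Complex.neg_re]
    congr 1
    linear_combination hsum
  -- Contradiction: `c = -Re X(φ) ≤ c * dualMnorm X < c`.
  have h1 := Complex.abs_re_le_norm (matFunctional X φ)
  have h2 := neg_abs_le (matFunctional X φ).re
  nlinarith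

end LocalLift

end

/-! ### Complete boundedness as inequalities between matrix norms -/

noncomputable section

section CompletelyBounded

open scoped ENNReal Topology
open Filter OperatorSpace Matrix

variable {E F : Type*} [NormedAddCommGroup E] [NormedSpace ℂ E] [OperatorSpace E]
  [NormedAddCommGroup F] [NormedSpace ℂ F] [OperatorSpace F]

theorem mnorm_map_le_of_cbNorm_le {T : E →ₗ[ℂ] F} {K : ℝ} (hK : 0 ≤ K)
    (hT : cbNorm T ≤ ENNReal.ofReal K) {n : ℕ} (x : Matrix (Fin n) (Fin n) E) :
    mnorm (x.map T) ≤ K * mnorm x := by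
  refine le_const_mul_of_forall_lt fun r hr => ?_
  have hr0 : 0 < r := (mnorm_nonneg x).trans_lt hr
  simp only [cbNorm, iSup_le_iff] at hT
  have h := hT n _ (mnorm_inv_smul_lt_one hr).le
  rw [ENNReal.ofReal_le_ofReal_iff hK] at h
  have e : (((r⁻¹ : ℝ) : ℂ) • x).map T = ((r⁻¹ : ℝ) : ℂ) • x.map T := by ext; simp
  rw [e, mnorm_smul, Complex.norm_real, Real.norm_of_nonneg (by positivity),
    inv_mul_le_iff₀ hr0] at h
  linarith

theorem cbNorm_le_of_mnorm_map_le {T : E →ₗ[ℂ] F} {K : ℝ} (hK : 0 ≤ K)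
    (hT : ∀ (n : ℕ) (x : Matrix (Fin n) (Fin n) E), mnorm (x.map T) ≤ K * mnorm x) :
    cbNorm T ≤ ENNReal.ofReal K := by
  refine iSup_le fun n => iSup₂_le fun x hx => ENNReal.ofReal_le_ofReal ((hT n x).trans ?_)
  exact mul_le_of_le_one_right hK hx

theorem norm_apply_le_of_mnorm_map_le {T : E →ₗ[ℂ] F} {K : ℝ}
    (hT : ∀ (n : ℕ) (x : Matrix (Fin n) (Fin n) E), mnorm (x.map T) ≤ K * mnorm x) (a : E) :
    ‖T a‖ ≤ K * ‖a‖ := by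
  have h := hT 1 (of fun _ _ => a)
  rw [mnorm_one] at h
  rwa [← mnorm_one (T a)]

end CompletelyBounded

/-! ### Ultraproducts of operators and stability of the OUAP -/

section UltraproductMaps

open scoped ENNReal Topology
open Filter OperatorSpace Matrix

variable {ι : Type*} {U : Ultrafilter ι} {E : ι → Type*} [∀ i, NormedAddCommGroup (E i)]
  [∀ i, NormedSpace ℂ (E i)]

theorem ultraproduct_mk_eq {x y : lp E ∞} (h : ∀ᶠ i in (U : Filter ι), x i = y i) :
    (Submodule.Quotient.mk x : Ultraproduct U E) = Submodule.Quotient.mk y := by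
  rw [Submodule.Quotient.eq]
  refine tendsto_const_nhds.congr' ?_
  filter_upwards [h] with i hi
  have : (x - y) i = x i - y i := rfl
  rw [this, hi, sub_self, norm_zero]

/-- Linear independence in an ultraproduct lifts to almost all the factors. -/
theorem eventually_linearIndependent {n : ℕ} (y : Fin n → lp E ∞)
    (h : LinearIndependent ℂ fun j => (Submodule.Quotient.mk (y j) : Ultraproduct U E)) :
    ∀ᶠ i in (U : Filter ι), LinearIndependent ℂ fun j => y j i := by
  by_contra hcon
  rw [← Ultrafilter.eventually_not] at hcon
  -- Relations are normalized to the unit sphere, so that their limit is a nontrivial relation.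
  have hex : ∀ i, ∃ c : Fin n → ℂ, ¬ LinearIndependent ℂ (fun j => y j i) →
      ‖c‖ = 1 ∧ ∑ j, c j • y j i = 0 := by
    intro i
    by_cases hi : LinearIndependent ℂ fun j => y j i
    · exact ⟨0, fun h => absurd hi h⟩
    · obtain ⟨g, hg, j, hj⟩ := Fintype.not_linearIndependent_iff.1 hi
      have hg0 : g ≠ 0 := fun h0 => hj (by rw [h0]; rfl)
      have hn : ‖g‖ ≠ 0 := norm_ne_zero_iff.2 hg0
      refine ⟨((‖g‖⁻¹ : ℝ) : ℂ) • g, fun _ => ⟨?_, ?_⟩⟩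
      · rw [norm_smul, Complex.norm_real, norm_inv, norm_norm, inv_mul_cancel₀ hn]
      · simp only [Pi.smul_apply, smul_eq_mul, mul_smul]
        rw [← Finset.smul_sum, hg, smul_zero]
  choose c hc using hex
  obtain ⟨c₀, hc₀, hlim⟩ := (isCompact_sphere (0 : Fin n → ℂ) 1).ultrafilter_le_nhds (U.map c) (by
    rw [le_principal_iff]
    refine Filter.mem_map.2 ?_
    filter_upwards [hcon] with i hi
    exact mem_sphere_zero_iff_norm.2 (hc i hi).1)
  have hlim' : Tendsto c U (𝓝 c₀) := hlim
  have hz : Tendsto (fun i => ‖(∑ j, c₀ j • y j : lp E ∞) i‖) U (𝓝 0) := by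
    have hs : Tendsto (fun i => ∑ j, ‖c₀ j - c i j‖ * ‖y j‖) U (𝓝 0) := by
      have h2 : Tendsto (fun i => ∑ j, ‖c₀ j - c i j‖ * ‖y j‖) U
          (𝓝 (∑ j, ‖c₀ j - c₀ j‖ * ‖y j‖)) :=
        tendsto_finsetSum _ fun j _ =>
          ((tendsto_const_nhds.sub (tendsto_pi_nhds.1 hlim' j)).norm).mul_const _
      simpa using h2
    refine squeeze_zero' (Eventually.of_forall fun i => norm_nonneg _) ?_ hs
    filter_upwards [hcon] with i hi
    -- Subtracting the exact relation at `i` leaves coefficients tending to zero.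
    have e : (∑ j, c₀ j • y j : lp E ∞) i = ∑ j, (c₀ j - c i j) • y j i := by
      simp only [sub_smul, Finset.sum_sub_distrib]
      rw [(hc i hi).2, sub_zero, coe_sum_apply]
      rfl
    rw [e]
    refine (norm_sum_le _ _).trans (Finset.sum_le_sum fun j _ => ?_)
    rw [norm_smul]
    exact mul_le_mul_of_nonneg_left (lp.norm_apply_le_norm ENNReal.top_ne_zero (y j) i)
      (norm_nonneg _)
  have h0 : (Submodule.Quotient.mk (∑ j, c₀ j • y j) : Ultraproduct U E) = 0 :=
    norm_eq_zero.1 (tendsto_nhds_unique (tendsto_norm_coord _) hz)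
  have h1 : ∑ j, c₀ j • (Submodule.Quotient.mk (y j) : Ultraproduct U E) = 0 := by
    rw [← h0]
    change _ = (ultraNull U E).mkQ _
    simp
  have h2 : c₀ = 0 := funext fun j => Fintype.linearIndependent_iff.1 h c₀ h1 j
  rw [mem_sphere_zero_iff_norm, h2, norm_zero] at hc₀
  exact zero_ne_one hc₀

/-- The operator `(x_i) ↦ (T_i x_i)` on bounded families, for uniformly bounded `T_i`. -/
def lpMap (T : ∀ i, E i →ₗ[ℂ] E i) {K : ℝ} (hK : 0 ≤ K) (hT : ∀ i a, ‖T i a‖ ≤ K * ‖a‖) :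
    lp E ∞ →ₗ[ℂ] lp E ∞ where
  toFun x := ⟨fun i => T i (x i), memℓp_infty ⟨K * ‖x‖, by
    rintro _ ⟨i, rfl⟩
    exact (hT i _).trans
      (mul_le_mul_of_nonneg_left (lp.norm_apply_le_norm ENNReal.top_ne_zero x i) hK)⟩⟩
  map_add' x y := by
    ext i
    exact map_add (T i) (x i) (y i)
  map_smul' c x := by
    ext i
    exact map_smul (T i) c (x i)

/-- The ultraproduct of uniformly bounded operators. -/
def ultraMap (U : Ultrafilter ι) (T : ∀ i, E i →ₗ[ℂ] E i) {K : ℝ} (hK : 0 ≤ K)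
    (hT : ∀ i a, ‖T i a‖ ≤ K * ‖a‖) : Ultraproduct U E →ₗ[ℂ] Ultraproduct U E :=
  (ultraNull U E).mapQ (ultraNull U E) (lpMap T hK hT) fun x hx => by
    have hx' : Tendsto (fun i => K * ‖x i‖) U (𝓝 (K * 0)) := Tendsto.const_mul K hx
    rw [mul_zero] at hx'
    exact squeeze_zero (fun i => norm_nonneg _) (fun i => hT i (x i)) hx'

/-- An independent family in the range lifts to images `T_i (w_l i)` that are independent for almost
all `i`; one index where the rank bound also holds suffices. -/
theorem finrank_range_ultraMap_le {T : ∀ i, E i →ₗ[ℂ] E i} {K : ℝ} (hK : 0 ≤ K)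
    (hT : ∀ i a, ‖T i a‖ ≤ K * ‖a‖) {d : ℕ} (hfin : ∀ i, FiniteDimensional ℂ (LinearMap.range (T i)))
    (hd : ∀ᶠ i in (U : Filter ι), Module.finrank ℂ (LinearMap.range (T i)) ≤ d) :
    FiniteDimensional ℂ (LinearMap.range (ultraMap U T hK hT)) ∧
      Module.finrank ℂ (LinearMap.range (ultraMap U T hK hT)) ≤ d := by
  have hrank : Module.rank ℂ (LinearMap.range (ultraMap U T hK hT)) ≤ d := by
    refine rank_le fun s hs => ?_
    have hs' : LinearIndependent ℂ fun l : Fin s.card =>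
        ((s.equivFin.symm l : LinearMap.range (ultraMap U T hK hT)) : Ultraproduct U E) :=
      (hs.comp _ s.equivFin.symm.injective).map' (Submodule.subtype _) (Submodule.ker_subtype _)
    have hex : ∀ l : Fin s.card, ∃ w : lp E ∞,
        (Submodule.Quotient.mk (lpMap T hK hT w) : Ultraproduct U E) =
          (s.equivFin.symm l : LinearMap.range (ultraMap U T hK hT)) := by
      intro l
      obtain ⟨z, hz⟩ := LinearMap.mem_range.1
        (s.equivFin.symm l : LinearMap.range (ultraMap U T hK hT)).2
      obtain ⟨w, rfl⟩ := Submodule.Quotient.mk_surjective _ z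
      exact ⟨w, hz⟩
    choose w hw using hex
    have hli := eventually_linearIndependent (U := U) (fun l => lpMap T hK hT (w l)) (by
      simpa only [hw] using hs')
    obtain ⟨i, hi, hdi⟩ := (hli.and hd).exists
    have hli' : LinearIndependent ℂ fun l =>
        (⟨T i (w l i), LinearMap.mem_range_self _ _⟩ : LinearMap.range (T i)) :=
      LinearIndependent.of_comp (LinearMap.range (T i)).subtype hi
    have := hfin i
    simpa using hli'.fintype_card_le_finrank.trans hdi
  exact ⟨Module.rank_lt_aleph0_iff.1 (hrank.trans_lt Cardinal.natCast_lt_aleph0),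
    Module.finrank_le_of_rank_le hrank⟩

variable [∀ i, OperatorSpace (E i)]

theorem mnorm_map_ultraMap_le {T : ∀ i, E i →ₗ[ℂ] E i} {K : ℝ} (hK : 0 ≤ K)
    (hT : ∀ i a, ‖T i a‖ ≤ K * ‖a‖)
    (hcb : ∀ i (n : ℕ) (x : Matrix (Fin n) (Fin n) (E i)), mnorm (x.map (T i)) ≤ K * mnorm x)
    {n : ℕ} (X : Matrix (Fin n) (Fin n) (Ultraproduct U E)) :
    mnorm (X.map (ultraMap U T hK hT)) ≤ K * mnorm X := by
  obtain ⟨x, rfl⟩ := exists_lift X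
  exact le_of_tendsto_of_tendsto' (tendsto_mnorm_coord (x.map (lpMap T hK hT)))
    ((tendsto_mnorm_coord x).const_mul K) fun i => hcb i n (coordMatrix x i)

/-- The `(K, k(n))`-OUAP is stable under ultraproducts. -/
theorem HasOUAP.ultraproduct {K : ℝ} (hK : 0 ≤ K) {k : ℕ → ℝ} (h : ∀ i, HasOUAP K k (E i)) :
    HasOUAP K k (Ultraproduct U E) := by
  intro n M hM hn
  let b := Module.finBasisOfFinrankEq ℂ M hn
  choose y hy using fun j => Submodule.Quotient.mk_surjective (ultraNull U E) (b j : Ultraproduct U E)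
  have hli := eventually_linearIndependent (U := U) y (by
    simp only [hy]
    exact b.linearIndependent.map' M.subtype M.ker_subtype)
  have hex : ∀ i, ∃ T : E i →ₗ[ℂ] E i,
      (∀ (m : ℕ) (x : Matrix (Fin m) (Fin m) (E i)), mnorm (x.map T) ≤ K * mnorm x) ∧
      FiniteDimensional ℂ (LinearMap.range T) ∧ (LinearIndependent ℂ (fun j => y j i) →
        (Module.finrank ℂ (LinearMap.range T) : ℝ) ≤ k n ∧ ∀ j, T (y j i) = y j i) := by
    intro i
    by_cases hi : LinearIndependent ℂ fun j => y j i
    · obtain ⟨T, -, hT1, hT2, hT3, hT4⟩ := h i n (Submodule.span ℂ (Set.range fun j => y j i))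
        (FiniteDimensional.span_of_finite ℂ (Set.finite_range _))
        (by rw [finrank_span_eq_card hi, Fintype.card_fin])
      exact ⟨T, fun m x => mnorm_map_le_of_cbNorm_le hK hT2 x, hT1, fun _ =>
        ⟨hT3, fun j => hT4 _ (Submodule.subset_span ⟨j, rfl⟩)⟩⟩
    -- These indices are negligible for `U`; the zero map only keeps the family uniformly completely
    -- bounded.
    · refine ⟨0, fun m x => ?_, ?_, fun h => absurd h hi⟩
      · have : x.map (0 : E i →ₗ[ℂ] E i) = 0 := by ext; simp
        rw [this, mnorm_zero]
        exact mul_nonneg hK (mnorm_nonneg x)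
      · rw [LinearMap.range_zero]
        infer_instance
  choose T hT1 hT2 hT3 using hex
  have hT0 : ∀ i a, ‖T i a‖ ≤ K * ‖a‖ := fun i => norm_apply_le_of_mnorm_map_le (hT1 i)
  have hcb : cbNorm (ultraMap U T hK hT0) ≤ ENNReal.ofReal K :=
    cbNorm_le_of_mnorm_map_le hK fun m X => mnorm_map_ultraMap_le hK hT0 hT1 X
  -- Since `k` is real-valued, the rank bound goes through `⌊k n⌋₊`, which is at most `k n` only if
  -- `k n ≥ 0`.
  have hkn : 0 ≤ k n := by
    obtain ⟨i, hi⟩ := hli.exists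
    exact (Nat.cast_nonneg _).trans (hT3 i hi).1
  obtain ⟨hr1, hr2⟩ := finrank_range_ultraMap_le (U := U) hK hT0 (d := ⌊k n⌋₊) hT2 (by
    filter_upwards [hli] with i hi
    exact Nat.le_floor (hT3 i hi).1)
  refine ⟨ultraMap U T hK hT0, hcb.trans_lt ENNReal.ofReal_lt_top, hr1, hcb,
    (Nat.le_floor_iff hkn).1 hr2, fun x hx => ?_⟩
  have hb : (ultraMap U T hK hT0 ∘ₗ M.subtype) = M.subtype := by
    refine b.ext fun j => ?_
    change ultraMap U T hK hT0 (b j) = b j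
    rw [← hy j]
    refine ultraproduct_mk_eq ?_
    filter_upwards [hli] with i hi
    exact (hT3 i hi).2 j
  exact LinearMap.congr_fun hb ⟨x, hx⟩

end UltraproductMaps

end

noncomputable section

section BidualRetract

open scoped ENNReal Topology Matrix.Norms.L2Operator
open Filter OperatorSpace Matrix

/-! ### Direct sums and compressions to blocks -/

section Blocks

variable {E : Type*} [NormedAddCommGroup E] [NormedSpace ℂ E] [OperatorSpace E]

theorem norm_le_one_of_conjTranspose_mul_self {m n : ℕ} {A : Matrix (Fin m) (Fin n) ℂ}
    (h : Aᴴ * A = 1) : ‖A‖ ≤ 1 := by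
  have h1 : ‖(1 : Matrix (Fin n) (Fin n) ℂ)‖ ≤ 1 :=
    scalar_norm_le _ zero_le_one fun v => by simp
  rw [← h, l2_opNorm_conjTranspose_mul_self] at h1
  nlinarith [norm_nonneg A]

theorem mnorm_matBimul_le_of_isometry {m n : ℕ} {A : Matrix (Fin m) (Fin n) ℂ} (h : Aᴴ * A = 1)
    (x : Matrix (Fin m) (Fin m) E) : mnorm (matBimul Aᵀ x A) ≤ mnorm x := by
  have h1 := norm_le_one_of_conjTranspose_mul_self h
  have h2 := (l2_opNorm_transpose_le A).trans h1
  have h3 := mnorm_nonneg x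
  calc _ ≤ ‖Aᵀ‖ * mnorm x * ‖A‖ := mnorm_bimul_le _ _ _
    _ ≤ 1 * mnorm x * 1 := by gcongr
    _ = _ := by ring

/-- The block `x` is the compression of `x ⊕ y` by the isometry with blocks `1` and `0`. -/
theorem mnorm_le_mnorm_directSum_left {m n : ℕ} (x : Matrix (Fin m) (Fin m) E)
    (y : Matrix (Fin n) (Fin n) E) : mnorm x ≤ mnorm (matDirectSum x y) := by
  have h := mnorm_matBimul_le_of_isometry (A := appendRows (1 : Matrix (Fin m) (Fin m) ℂ)
    (0 : Matrix (Fin n) (Fin m) ℂ)) (by rw [appendRows_conjTranspose_mul_self]; simp)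
    (matDirectSum x y)
  rw [matBimul_appendRows, transpose_one, matBimul_one_one] at h
  have e : matBimul (0 : Matrix (Fin n) (Fin m) ℂ)ᵀ y (0 : Matrix (Fin n) (Fin m) ℂ) = 0 := by
    ext; simp [matBimul]
  rwa [e, add_zero] at h

theorem mnorm_le_mnorm_directSum_right {m n : ℕ} (x : Matrix (Fin m) (Fin m) E)
    (y : Matrix (Fin n) (Fin n) E) : mnorm y ≤ mnorm (matDirectSum x y) := by
  have h := mnorm_matBimul_le_of_isometry (A := appendRows (0 : Matrix (Fin m) (Fin n) ℂ)
    (1 : Matrix (Fin n) (Fin n) ℂ)) (by rw [appendRows_conjTranspose_mul_self]; simp)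
    (matDirectSum x y)
  rw [matBimul_appendRows, transpose_one, matBimul_one_one] at h
  have e : matBimul (0 : Matrix (Fin m) (Fin n) ℂ)ᵀ x (0 : Matrix (Fin m) (Fin n) ℂ) = 0 := by
    ext; simp [matBimul]
  rwa [e, zero_add] at h

theorem matDirectSum_map {F G : Type*} [AddCommGroup F] [Module ℂ F] [AddCommGroup G] [Module ℂ G]
    {m n : ℕ} (x : Matrix (Fin m) (Fin m) F) (y : Matrix (Fin n) (Fin n) F) (A : F →ₗ[ℂ] G) :
    (matDirectSum x y).map A = matDirectSum (x.map A) (y.map A) := by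
  ext a b
  induction a using Fin.addCases <;> induction b using Fin.addCases <;> simp [matDirectSum]

/-- Finitely many matrices in the open unit balls are the blocks of a single one. -/
theorem exists_common_matrix {F : Type*} [NormedAddCommGroup F] [NormedSpace ℂ F]
    [OperatorSpace F]
    (S : Finset (Σ n : ℕ, {X : Matrix (Fin n) (Fin n) F // mnorm X < 1})) :
    ∃ (n : ℕ) (X : Matrix (Fin n) (Fin n) F), mnorm X < 1 ∧ ∀ A : F →ₗ[ℂ] E,
      mnorm (X.map A) < 1 → ∀ s ∈ S, mnorm (s.2.1.map A) < 1 := by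
  classical
  induction S using Finset.induction_on with
  | empty => exact ⟨0, 0, by rw [mnorm_zero]; norm_num, by simp⟩
  | insert s S _ ih =>
    obtain ⟨n, X, hX, hS⟩ := ih
    refine ⟨s.1 + n, matDirectSum s.2.1 X,
      (mnorm_directSum_le _ _).trans_lt (max_lt s.2.2 hX), fun A hA => ?_⟩
    rw [matDirectSum_map] at hA
    intro t ht
    rcases Finset.mem_insert.1 ht with rfl | ht
    · exact (mnorm_le_mnorm_directSum_left _ _).trans_lt hA
    · exact hS A ((mnorm_le_mnorm_directSum_right _ _).trans_lt hA) t ht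

theorem norm_dualPairing_le_mul {n m : ℕ} (φ : Matrix (Fin n) (Fin n) (StrongDual ℂ E))
    (x : Matrix (Fin m) (Fin m) E) : ‖dualPairing φ x‖ ≤ dualMnorm φ * mnorm x := by
  refine le_const_mul_of_forall_lt fun r hr => ?_
  have hr0 : 0 < r := (mnorm_nonneg x).trans_lt hr
  have h := norm_dualPairing_le_dualMnorm φ ⟨m, _, (mnorm_inv_smul_lt_one hr).le⟩
  have e : dualPairing φ (((r⁻¹ : ℝ) : ℂ) • x) = ((r⁻¹ : ℝ) : ℂ) • dualPairing φ x := by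
    ext; simp [dualPairing]
  rw [e, norm_smul, Complex.norm_real, Real.norm_of_nonneg (by positivity),
    inv_mul_le_iff₀ hr0] at h
  linarith

end Blocks

/-! ### Weak* limits: from the ultrapower to the bidual -/

section WeakLimit

variable {ι : Type*} (U : Ultrafilter ι) (E : Type*) [NormedAddCommGroup E] [NormedSpace ℂ E]

variable {E} in
theorem tendsto_limUnder_apply (y : lp (fun _ : ι => E) ∞) (g : StrongDual ℂ E) :
    Tendsto (fun i => g (y i)) U (𝓝 (limUnder (U : Filter ι) fun i => g (y i))) := by
  refine tendsto_nhds_limUnder ?_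
  obtain ⟨L, -, hL⟩ := (isCompact_closedBall (0 : ℂ) (‖g‖ * ‖y‖)).ultrafilter_le_nhds
    (U.map fun i => g (y i)) (by
      rw [le_principal_iff]
      refine Filter.mem_map.2 (Filter.univ_mem' fun i => mem_closedBall_zero_iff.2 ?_)
      exact (g.le_opNorm _).trans (mul_le_mul_of_nonneg_left
        (lp.norm_apply_le_norm ENNReal.top_ne_zero y i) (norm_nonneg g)))
  exact ⟨L, hL⟩

/-- The weak* limit `lim_U y_i ∈ E**` of a bounded family in `E`. -/
def lpWeakLimit : lp (fun _ : ι => E) ∞ →ₗ[ℂ] StrongDual ℂ (StrongDual ℂ E) where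
  toFun y := LinearMap.mkContinuous
    { toFun := fun g => limUnder (U : Filter ι) fun i => g (y i)
      map_add' := fun g h =>
        ((tendsto_limUnder_apply U y g).add (tendsto_limUnder_apply U y h)).limUnder_eq
      map_smul' := fun c g => ((tendsto_limUnder_apply U y g).const_mul c).limUnder_eq } ‖y‖
    fun g => le_of_tendsto' (tendsto_limUnder_apply U y g).norm fun i => by
      refine (g.le_opNorm _).trans ?_
      rw [mul_comm]
      exact mul_le_mul_of_nonneg_right (lp.norm_apply_le_norm ENNReal.top_ne_zero y i)
        (norm_nonneg g)
  map_add' y z := by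
    ext g
    refine Tendsto.limUnder_eq (((tendsto_limUnder_apply U y g).add
      (tendsto_limUnder_apply U z g)).congr fun i => ?_)
    exact (map_add g (y i) (z i)).symm
  map_smul' c y := by
    ext g
    refine Tendsto.limUnder_eq (((tendsto_limUnder_apply U y g).const_mul c).congr fun i => ?_)
    exact (map_smul g c (y i)).symm

theorem ultraNull_le_ker_lpWeakLimit :
    (ultraNull U fun _ : ι => E) ≤ LinearMap.ker (lpWeakLimit U E) := by
  intro y hy
  have hy' : Tendsto (fun i => ‖y i‖) U (𝓝 0) := hy
  rw [LinearMap.mem_ker]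
  ext g
  refine Tendsto.limUnder_eq (squeeze_zero_norm (fun i => g.le_opNorm (y i)) ?_)
  simpa using hy'.const_mul ‖g‖

/-- The map from the ultrapower to the bidual given by weak* limits. -/
def ultraWeakLimit : Ultraproduct U (fun _ : ι => E) →ₗ[ℂ] StrongDual ℂ (StrongDual ℂ E) :=
  Submodule.liftQ (R₂ := ℂ) (M₂ := StrongDual ℂ (StrongDual ℂ E)) (τ₁₂ := RingHom.id ℂ)
    (ultraNull U fun _ : ι => E) (lpWeakLimit U E) (ultraNull_le_ker_lpWeakLimit U E)

variable {E}

theorem tendsto_ultraWeakLimit (y : lp (fun _ : ι => E) ∞) (g : StrongDual ℂ E) :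
    Tendsto (fun i => g (y i)) U
      (𝓝 (ultraWeakLimit U E (Submodule.Quotient.mk y) g)) :=
  tendsto_limUnder_apply U y g

variable [OperatorSpace E]

/-- Weak* lower semicontinuity: each bilinear form of the pairing with `ψ` is the limit of those of
`ψ` with `y_i`, up to exchanging the two tensor factors, and these are bounded by `‖ψ‖ ‖y_i‖`. -/
theorem dualMnorm_map_ultraWeakLimit_le {n : ℕ}
    (Y : Matrix (Fin n) (Fin n) (Ultraproduct U fun _ : ι => E)) :
    dualMnorm (Y.map (ultraWeakLimit U E)) ≤ mnorm Y := by
  obtain ⟨y, rfl⟩ := exists_lift Y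
  refine ciSup_le fun p => ?_
  obtain ⟨m, ψ, hψ⟩ := p
  refine scalar_norm_le_of_bilin _ (mnorm_nonneg _) fun w v => ?_
  have hswap : ∀ u : Fin n × Fin m → ℂ,
      ‖WithLp.toLp 2 (fun p : Fin m × Fin n => u (p.2, p.1))‖ = ‖WithLp.toLp 2 u‖ := by
    intro u
    rw [← sq_eq_sq₀ (norm_nonneg _) (norm_nonneg _), EuclideanSpace.norm_sq_eq,
      EuclideanSpace.norm_sq_eq, Fintype.sum_prod_type, Fintype.sum_prod_type, Finset.sum_comm]
  have hlim : Tendsto (fun i => (fun p : Fin m × Fin n => w (p.2, p.1)) ⬝ᵥ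
      (dualPairing ψ (coordMatrix y i)).mulVec (fun p : Fin m × Fin n => v (p.2, p.1))) U
      (𝓝 (w ⬝ᵥ (dualPairing ((y.map (Submodule.Quotient.mk (p := ultraNull U fun _ : ι => E))).map
        (ultraWeakLimit U E)) ψ).mulVec v)) := by
    have e : w ⬝ᵥ (dualPairing ((y.map (Submodule.Quotient.mk
        (p := ultraNull U fun _ : ι => E))).map (ultraWeakLimit U E)) ψ).mulVec v =
        ∑ a : Fin m, ∑ k : Fin n, w (k, a) * ∑ b : Fin m, ∑ l : Fin n,
          ultraWeakLimit U E (Submodule.Quotient.mk (y k l)) (ψ a b) * v (l, b) := by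
      simp only [dotProduct, mulVec, dualPairing, of_apply, Fintype.sum_prod_type, map_apply]
      rw [Finset.sum_comm]
      refine Finset.sum_congr rfl fun a _ => Finset.sum_congr rfl fun k _ => ?_
      rw [Finset.sum_comm]
    rw [e]
    simp only [dotProduct, mulVec, dualPairing, of_apply, Fintype.sum_prod_type]
    refine tendsto_finsetSum _ fun a _ => tendsto_finsetSum _ fun k _ => Tendsto.const_mul _ ?_
    refine tendsto_finsetSum _ fun b _ => tendsto_finsetSum _ fun l _ => Tendsto.mul_const _ ?_
    exact tendsto_ultraWeakLimit U (y k l) (ψ a b)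
  refine le_of_tendsto_of_tendsto' hlim.norm ((tendsto_mnorm_coord y).mul_const _) fun i => ?_
  refine (scalar_bilin_le _ _ _).trans ?_
  rw [hswap, hswap]
  refine mul_le_mul_of_nonneg_right ?_ (by positivity)
  exact (norm_dualPairing_le_mul _ _).trans (mul_le_of_le_one_left (mnorm_nonneg _) hψ)

end WeakLimit

/-! ### From approximating maps to the ultrapower -/

section Embedding

variable {ι : Type*} {U : Ultrafilter ι} {E F : Type*} [NormedAddCommGroup E] [NormedSpace ℂ E]
  [OperatorSpace E] [NormedAddCommGroup F] [NormedSpace ℂ F] [OperatorSpace F]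

/-- A family of linear maps which is eventually contractive on each matrix defines a complete
contraction into the ultrapower. -/
theorem exists_ultrapower_map (A : ι → F →ₗ[ℂ] E)
    (hA : ∀ (n : ℕ) (X : Matrix (Fin n) (Fin n) F), mnorm X < 1 →
      ∀ᶠ i in (U : Filter ι), mnorm (X.map (A i)) < 1) :
    ∃ J : F →ₗ[ℂ] Ultraproduct U (fun _ : ι => E),
      (∀ (n : ℕ) (X : Matrix (Fin n) (Fin n) F), mnorm (X.map J) ≤ mnorm X) ∧
      ∀ x, ∃ y : lp (fun _ : ι => E) ∞, J x = Submodule.Quotient.mk y ∧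
        ∀ᶠ i in (U : Filter ι), y i = A i x := by
  classical
  have hlt : ∀ (n : ℕ) (X : Matrix (Fin n) (Fin n) F) (r : ℝ), mnorm X < r →
      ∀ᶠ i in (U : Filter ι), mnorm (X.map (A i)) < r := by
    intro n X r hr
    have hr0 : 0 < r := (mnorm_nonneg X).trans_lt hr
    filter_upwards [hA n _ (mnorm_inv_smul_lt_one hr)] with i hi
    have e : (((r⁻¹ : ℝ) : ℂ) • X).map (A i) = ((r⁻¹ : ℝ) : ℂ) • X.map (A i) := by ext; simp
    rwa [e, mnorm_smul, Complex.norm_real, Real.norm_of_nonneg (by positivity),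
      inv_mul_lt_one₀ hr0] at hi
  have hbd : ∀ x, ∀ᶠ i in (U : Filter ι), ‖A i x‖ ≤ ‖x‖ + 1 := by
    intro x
    filter_upwards [hlt 1 (of fun _ _ => x) (‖x‖ + 1) (by rw [mnorm_one]; linarith)] with i hi
    rw [← mnorm_one]
    exact hi.le
  -- Truncation turns the merely eventual bound on `A i x` into a bounded family. It destroys
  -- linearity of `j`, which is restored in the quotient.
  let j : F → lp (fun _ : ι => E) ∞ := fun x =>
    ⟨fun i => if ‖A i x‖ ≤ ‖x‖ + 1 then A i x else 0, memℓp_infty ⟨‖x‖ + 1, by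
      rintro _ ⟨i, rfl⟩
      dsimp only
      split_ifs with h
      · exact h
      · rw [norm_zero]; positivity⟩⟩
  have hj : ∀ x, ∀ᶠ i in (U : Filter ι), j x i = A i x := by
    intro x
    filter_upwards [hbd x] with i hi
    exact if_pos hi
  let J : F →ₗ[ℂ] Ultraproduct U (fun _ : ι => E) :=
    { toFun := fun x => Submodule.Quotient.mk (j x)
      map_add' := fun x z => by
        rw [← Submodule.Quotient.mk_add]
        refine ultraproduct_mk_eq ?_
        filter_upwards [hj x, hj z, hj (x + z)] with i h1 h2 h3
        rw [h3, map_add, ← h1, ← h2]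
        rfl
      map_smul' := fun c x => by
        rw [RingHom.id_apply, ← Submodule.Quotient.mk_smul]
        refine ultraproduct_mk_eq ?_
        filter_upwards [hj x, hj (c • x)] with i h1 h2
        rw [h2, map_smul, ← h1]
        rfl }
  refine ⟨J, fun n X => ?_, fun x => ⟨j x, rfl, hj x⟩⟩
  refine le_of_forall_gt_imp_ge_of_dense fun r hr => ?_
  refine le_of_tendsto (tendsto_mnorm_coord (U := U) (X.map j)) ?_
  have hev : ∀ᶠ i in (U : Filter ι), ∀ k l, j (X k l) i = A i (X k l) :=
    eventually_all.2 fun k => eventually_all.2 fun l => hj (X k l)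
  filter_upwards [hlt n X r hr, hev] with i h1 h2
  have e : coordMatrix (X.map j) i = X.map (A i) := by
    ext k l
    exact h2 k l
  rw [e]
  exact h1.le

end Embedding

end BidualRetract

end

/-! ### The bidual as a retract of an ultrapower -/

noncomputable section

section BidualOUAP

open scoped ENNReal Topology
open Filter OperatorSpace Matrix

/-- The `(K, k(n))`-OUAP passes to completely contractively complemented subspaces. -/
theorem HasOUAP.of_retract {F G : Type*} [NormedAddCommGroup F] [NormedSpace ℂ F] [OperatorSpace F]
    [NormedAddCommGroup G] [NormedSpace ℂ G] [OperatorSpace G] {K : ℝ} (hK : 0 ≤ K) {k : ℕ → ℝ}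
    (hG : HasOUAP K k G) (J : F →ₗ[ℂ] G) (Q : G →ₗ[ℂ] F)
    (hJ : ∀ (n : ℕ) (X : Matrix (Fin n) (Fin n) F), mnorm (X.map J) ≤ mnorm X)
    (hQ : ∀ (n : ℕ) (Y : Matrix (Fin n) (Fin n) G), mnorm (Y.map Q) ≤ mnorm Y)
    (hQJ : ∀ x, Q (J x) = x) : HasOUAP K k F := by
  intro n M hM hn
  have hinj : Function.Injective J := Function.LeftInverse.injective hQJ
  obtain ⟨T, -, hT1, hT2, hT3, hT4⟩ := hG n (M.map J) inferInstance
    ((LinearEquiv.finrank_eq (Submodule.equivMapOfInjective J hinj M)).symm.trans hn)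
  have hcb : cbNorm (Q ∘ₗ T ∘ₗ J) ≤ ENNReal.ofReal K := by
    refine cbNorm_le_of_mnorm_map_le hK fun m X => ?_
    exact (hQ m ((X.map J).map T)).trans ((mnorm_map_le_of_cbNorm_le hK hT2 _).trans
      (mul_le_mul_of_nonneg_left (hJ m X) hK))
  have hrange : LinearMap.range (Q ∘ₗ T ∘ₗ J) ≤ (LinearMap.range T).map Q := by
    rw [LinearMap.range_comp]
    exact Submodule.map_mono (LinearMap.range_comp_le_range J T)
  refine ⟨Q ∘ₗ T ∘ₗ J, hcb.trans_lt ENNReal.ofReal_lt_top,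
    Submodule.finiteDimensional_of_le hrange, hcb, ?_, fun x hx => ?_⟩
  · refine le_trans ?_ hT3
    exact_mod_cast (Submodule.finrank_mono hrange).trans (Submodule.finrank_map_le Q _)
  · change Q (T (J x)) = x
    rw [hT4 _ (Submodule.mem_map_of_mem hx), hQJ]

theorem exists_ultrafilter_eventually_ge (α β : Type*) :
    ∃ U : Ultrafilter (Finset α × Finset β × ℕ), ∀ i₀, ∀ᶠ i in (U : Filter (Finset α × Finset β × ℕ)),
      i₀ ≤ i := by
  classical
  exact ⟨Ultrafilter.of atTop, fun i₀ => (Ultrafilter.of_le atTop) (eventually_ge_atTop i₀)⟩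

universe u

/-- The bidual of an operator space is completely contractively complemented in an ultrapower. -/
theorem exists_bidual_retract_of_ultrapower (E : Type u) [NormedAddCommGroup E] [NormedSpace ℂ E]
    [OperatorSpace E] :
    ∃ (ι : Type u) (U : Ultrafilter ι)
      (J : StrongDual ℂ (StrongDual ℂ E) →ₗ[ℂ] Ultraproduct U (fun _ : ι => E)),
      (∀ (n : ℕ) (X : Matrix (Fin n) (Fin n) (StrongDual ℂ (StrongDual ℂ E))),
        mnorm (X.map J) ≤ dualMnorm X) ∧ ∀ x, ultraWeakLimit U E (J x) = x := by
  classical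
  -- An index records which matrices must stay in the unit ball, which pairings must be
  -- approximated, and the precision `1 / (N + 1)`. The ultrafilter contains every tail of this
  -- directed set.
  let ι := Finset (Σ n : ℕ, {X : Matrix (Fin n) (Fin n) (StrongDual ℂ (StrongDual ℂ E)) //
    dualMnorm X < 1}) × Finset (StrongDual ℂ (StrongDual ℂ E) × StrongDual ℂ E) × ℕ
  have hex : ∀ i : ι, ∃ A : StrongDual ℂ (StrongDual ℂ E) →ₗ[ℂ] E,
      (∀ s ∈ i.1, mnorm (s.2.1.map A) < 1) ∧
      ∀ p ∈ i.2.1, ‖p.2 (A p.1) - p.1 p.2‖ < 1 / ((i.2.2 : ℝ) + 1) := by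
    rintro ⟨S, G, N⟩
    obtain ⟨n, X, hX, hS⟩ := exists_common_matrix (E := E) (F := StrongDual ℂ (StrongDual ℂ E)) S
    obtain ⟨A, hA1, hA2⟩ := exists_linearMap_mnorm_lt_one X hX (fun p : G => p.1.1)
      (fun p : G => p.1.2) (δ := 1 / ((N : ℝ) + 1)) (by positivity)
    exact ⟨A, hS A hA1, fun p hp => hA2 ⟨p, hp⟩⟩
  choose A hA1 hA2 using hex
  obtain ⟨U, hU⟩ : ∃ U : Ultrafilter ι, ∀ i₀ : ι, ∀ᶠ i in (U : Filter ι), i₀ ≤ i :=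
    exists_ultrafilter_eventually_ge _ _
  obtain ⟨J, hJ1, hJ2⟩ := exists_ultrapower_map (U := U) (E := E)
    (F := StrongDual ℂ (StrongDual ℂ E)) A (fun n X hX => by
      filter_upwards [hU ({⟨n, X, hX⟩}, ∅, 0)] with i hi
      exact hA1 i ⟨n, X, hX⟩ (hi.1 (Finset.mem_singleton_self _)))
  refine ⟨ι, U, J, hJ1, fun x => ?_⟩
  obtain ⟨y, hy, hyA⟩ := hJ2 x
  ext g
  rw [hy]
  refine tendsto_nhds_unique (tendsto_ultraWeakLimit U y g) ?_
  rw [Metric.tendsto_nhds]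
  intro ε hε
  obtain ⟨N, hN⟩ := exists_nat_one_div_lt hε
  -- Beyond this index, `g (A_i x)` is within `1 / (N + 1) < ε` of `x g`, so the weak* limit of `A_i
  -- x` is `x`.
  filter_upwards [hyA, hU (∅, {(x, g)}, N)] with i h1 h2
  rw [h1, dist_eq_norm]
  refine (hA2 i (x, g) (h2.2.1 (Finset.mem_singleton_self _))).trans (lt_of_le_of_lt ?_ hN)
  have : (N : ℝ) ≤ i.2.2 := by exact_mod_cast h2.2.2
  gcongr

/-- The `(K, k(n))`-OUAP passes to the bidual. -/
theorem HasOUAP.bidual {E : Type*} [NormedAddCommGroup E] [NormedSpace ℂ E] [OperatorSpace E]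
    {K : ℝ} (hK : 0 ≤ K) {k : ℕ → ℝ} (h : HasOUAP K k E) :
    HasOUAP K k (StrongDual ℂ (StrongDual ℂ E)) := by
  obtain ⟨ι, U, J, hJ, hQJ⟩ := exists_bidual_retract_of_ultrapower E
  exact HasOUAP.of_retract (F := StrongDual ℂ (StrongDual ℂ E)) hK
    (HasOUAP.ultraproduct (U := U) hK fun _ => h) J (ultraWeakLimit U E) hJ
    (fun _ Y => dualMnorm_map_ultraWeakLimit_le U Y) hQJ

end BidualOUAP

end

theorem mainTheorem6 (K : ℝ) (hK : 1 ≤ K) (k : ℕ → ℝ) :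
    (∀ (ι : Type*) (U : Ultrafilter ι) (E : ι → Type*) [∀ i, NormedAddCommGroup (E i)]
      [∀ i, NormedSpace ℂ (E i)] [∀ i, OperatorSpace (E i)],
      (∀ i, HasOUAP K k (E i)) → HasOUAP K k (Ultraproduct U E)) ∧
    (∀ (E : Type*) [NormedAddCommGroup E] [NormedSpace ℂ E] [OperatorSpace E],
      HasOUAP K k E → HasOUAP K k (StrongDual ℂ (StrongDual ℂ E))) :=
  ⟨fun _ _ _ _ _ _ h => HasOUAP.ultraproduct (zero_le_one.trans hK) h,
    fun _ _ _ _ h => h.bidual (zero_le_one.trans hK)⟩
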